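/- **Conventions.** A Riemannian manifold here is a smooth, connected, second countable Hausdorff manifold without boundary with a smooth Riemannian metric. A complete Riemannian manifold $(M,g)$ is *asymptotically cylindrical (ACyl) of rate $\delta>0$* if there are a bounded open set $U\subset M$, a connected closed Riemannian manifold $(L,g_L)$ and a diffeomorphism $\Phi:[0,\infty)\times L\to M\setminus U$ such that $$|\nabla^k(\Phi^*g-g_{cyl})|=O(e^{-\delta t})\quad\text{as } t\to\infty,\qquad\text{for all } k\in\mathbb N_0,$$ where $g_{cyl}=dt^2+g_L$, $\nabla$ and $|\cdot|$ are the Levi-Civita connection and the norm of $g_{cyl}$, and $t$ is the projection onto $[0,\infty)$. A *cylindrical coordinate function* is a smooth function $t:M\to\mathbb R$ extending $t\circ\Phi^{-1}$. For $\varepsilon\in\mathbb R$ and $k\in\mathbb N_0$, $C^k_\varepsilon(M)$ is the space of $C^k$-functions $u$ on $M$ with $\sum_{j=0}^k\sup_M|e^{\varepsilon t}\nabla^j u|_g<\infty$, where $\nabla$ is now the Levi-Civita connection of $g$. **Proposition 2.12.** Let $(M,g)$ be an ACyl manifold of some rate $\delta>0$ with cylindrical coordinate function $t$, and let $f$ be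 a $C^2$-function on $M$ with $f-2t\in C^2_{\delta_0}(M)$ for some $\delta_0>0$. Then there is a constant $c>0$ with $f+c>0$ on $M$, and for every such $c$ there exists a constant $\lambda>0$ such that $$\lambda\int_M u^2\,\frac{e^f}{(f+c)^2}\,dV_g\;\le\;\int_M|\nabla^g u|_g^2\,\frac{e^f}{(f+c)^2}\,dV_g$$ for all smooth, compactly supported functions $u:M\to\mathbb R$. -/

import Mathlib

open Set Filter Topology MeasureTheory Manifold Bundle
open scoped ContDiff

noncomputable section

namespace ACyl

/-! ### Tensor calculus in one coordinate chart

`E` is the model space with basis `b` (the coordinate directions), `G : E → Matrix ι ι ℝ` the matrix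
`g_ij` of a Riemannian metric in a chart, and a covariant tensor field of rank `k` is given by its
components `T y I`, where `I : Fin k → ι` is a multi-index. -/

section Local

variable {ι : Type*} [Fintype ι] [DecidableEq ι]
  {E : Type*} [NormedAddCommGroup E] [NormedSpace ℝ E]

/-- The Christoffel symbol `Γ^p_ij = ½ g^{pq} (∂_i g_jq + ∂_j g_iq - ∂_q g_ij)` of the Levi-Civita
connection. -/
def christoffel (b : Module.Basis ι ℝ E) (G : E → Matrix ι ι ℝ) (y : E) (p i j : ι) : ℝ :=
  2⁻¹ * ∑ q, (G y)⁻¹ p q *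
    (fderiv ℝ (fun z => G z j q) y (b i) + fderiv ℝ (fun z => G z i q) y (b j)
      - fderiv ℝ (fun z => G z i j) y (b q))

/-- The covariant derivative of a covariant `k`-tensor field:
`(∇T)_{a i_1 … i_k} = ∂_a T_{i_1 … i_k} - ∑_l Γ^p_{a i_l} T_{i_1 … p … i_k}`. -/
def covDeriv (b : Module.Basis ι ℝ E) (G : E → Matrix ι ι ℝ) {k : ℕ}
    (T : E → (Fin k → ι) → ℝ) : E → (Fin (k + 1) → ι) → ℝ :=
  fun y I => fderiv ℝ (fun z => T z (Fin.tail I)) y (b (I 0))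
    - ∑ l : Fin k, ∑ p, christoffel b G y p (I 0) (I l.succ)
        * T y (Function.update (Fin.tail I) l p)

/-- The iterated covariant derivative `∇^j T`. -/
def iterCovDeriv (b : Module.Basis ι ℝ E) (G : E → Matrix ι ι ℝ) {k : ℕ}
    (T : E → (Fin k → ι) → ℝ) : (j : ℕ) → E → (Fin (k + j) → ι) → ℝ
  | 0 => T
  | j + 1 => covDeriv b G (iterCovDeriv b G T j)

/-- The norm `|S|_g = (g^{i_1 j_1} ⋯ g^{i_k j_k} S_{i_1 … i_k} S_{j_1 … j_k})^{1/2}` of a covariant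
`k`-tensor at a point where the metric has matrix `A = (g_ij)`. -/
def tensorNorm (A : Matrix ι ι ℝ) {k : ℕ} (S : (Fin k → ι) → ℝ) : ℝ :=
  √(∑ I, ∑ J, (∏ l, A⁻¹ (I l) (J l)) * S I * S J)

end Local

/-! ### Tensors on manifolds -/

section Manifold

variable {ι : Type*} [Fintype ι] [DecidableEq ι]
  {E : Type*} [NormedAddCommGroup E] [NormedSpace ℝ E]
  {H : Type*} [TopologicalSpace H] (I : ModelWithCorners ℝ E H)
  {N : Type*} [TopologicalSpace N] [ChartedSpace H N]

/-- The coordinate vector `∂_i` of the preferred chart around `x`, at the point with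
coordinates `y`. -/
def coordVec (b : Module.Basis ι ℝ E) (x : N) (y : E) (i : ι) :
    TangentSpace I ((extChartAt I x).symm y) :=
  mfderiv 𝓘(ℝ, E) I (extChartAt I x).symm y (b i)

/-- The components of the 2-tensor field `h` in the preferred chart around `x`. -/
def coordMatrix (b : Module.Basis ι ℝ E) (h : ∀ p : N, TangentSpace I p → TangentSpace I p → ℝ)
    (x : N) (y : E) : Matrix ι ι ℝ :=
  Matrix.of fun i j => h ((extChartAt I x).symm y) (coordVec I b x y i) (coordVec I b x y j)

/-- The pointwise norm `|∇^j h|_g` at `p` of the `j`-th covariant derivative of a 2-tensor field `h`,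
where `g` is a Riemannian metric and `∇` its Levi-Civita connection; it is
computed in the preferred chart around `p`. -/
def covNorm₂ (b : Module.Basis ι ℝ E) (g h : ∀ p : N, TangentSpace I p → TangentSpace I p → ℝ)
    (j : ℕ) (p : N) : ℝ :=
  tensorNorm (coordMatrix I b g p (extChartAt I p p))
    (iterCovDeriv b (coordMatrix I b g p)
      (fun y (K : Fin 2 → ι) => coordMatrix I b h p y (K 0) (K 1)) j (extChartAt I p p))

/-- The pointwise norm `|∇^j u|_g` at `p` of the `j`-th covariant derivative of a function `u`. -/
def covNorm₀ (b : Module.Basis ι ℝ E) (g : ∀ p : N, TangentSpace I p → TangentSpace I p → ℝ)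
    (u : N → ℝ) (j : ℕ) (p : N) : ℝ :=
  tensorNorm (coordMatrix I b g p (extChartAt I p p))
    (iterCovDeriv b (coordMatrix I b g p)
      (fun y (_ : Fin 0 → ι) => u ((extChartAt I p).symm y)) j (extChartAt I p p))

end Manifold

/-! ### Riemannian manifolds of dimension `m` -/

section Riemannian

/-- The standard basis of `ℝ^m`. -/
abbrev stdBasis (m : ℕ) : Module.Basis (Fin m) ℝ (EuclideanSpace ℝ (Fin m)) :=
  (EuclideanSpace.basisFun (Fin m) ℝ).toBasis

variable (m : ℕ) {M : Type*} [TopologicalSpace M] [ChartedSpace (EuclideanSpace ℝ (Fin m)) M]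
  [RiemannianBundle (fun p : M => TangentSpace (𝓡 m) p)]

/-- The metric tensor `g` of a Riemannian manifold. -/
def metricTensor (p : M) (v w : TangentSpace (𝓡 m) p) : ℝ := inner ℝ v w

/-- The Riemannian volume measure `dV_g`: in every chart it is `√(det g_ij) dx`. The measures on the
chart domains defined by this formula agree on overlaps, so that their least upper bound is the
measure on `M` that restricts to each of them. -/
def volumeMeasure [MeasurableSpace M] : Measure M :=
  ⨆ x : M, Measure.map (extChartAt (𝓡 m) x).symm
    (((volume : Measure (EuclideanSpace ℝ (Fin m))).withDensity fun y =>
      ENNReal.ofReal √(coordMatrix (𝓡 m) (stdBasis m) (metricTensor m) x y).det).restrict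
      (extChartAt (𝓡 m) x).target)

/-- The Riemannian gradient: the vector with `g(∇u, v) = du(v)` for all `v`. -/
def riemGradient (u : M → ℝ) (p : M) : TangentSpace (𝓡 m) p :=
  haveI : FiniteDimensional ℝ (TangentSpace (𝓡 m) p) :=
    inferInstanceAs (FiniteDimensional ℝ (EuclideanSpace ℝ (Fin m)))
  haveI : CompleteSpace (TangentSpace (𝓡 m) p) := FiniteDimensional.complete ℝ _
  (InnerProductSpace.toDual ℝ (TangentSpace (𝓡 m) p)).symm (mvfderiv (𝓡 m) u p)

end Riemannian

/-! ### Asymptotically cylindrical manifolds -/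

section Cylinder

variable (d : ℕ)

/-- The model with corners of the cylinder `ℝ × L`, where `L` has dimension `d`. -/
abbrev cylModel := (𝓘(ℝ, ℝ)).prod (𝓡 d)

/-- The standard basis of `ℝ × ℝ^d`. -/
abbrev cylBasis : Module.Basis (Unit ⊕ Fin d) ℝ (ℝ × EuclideanSpace ℝ (Fin d)) :=
  (Module.Basis.singleton Unit ℝ).prod (stdBasis d)

variable {L : Type*} [TopologicalSpace L] [ChartedSpace (EuclideanSpace ℝ (Fin d)) L]
  [IsManifold (𝓡 d) ∞ L]

/-- The product metric `g_cyl = dt² + g_L` on `ℝ × L`. -/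
def cylMetric
    (gL : ContMDiffRiemannianMetric (𝓡 d) ∞ (EuclideanSpace ℝ (Fin d))
      (fun x : L => TangentSpace (𝓡 d) x))
    (q : ℝ × L) (v w : TangentSpace (cylModel d) q) : ℝ :=
  mvfderiv (cylModel d) (Prod.fst : ℝ × L → ℝ) q v * mvfderiv (cylModel d) (Prod.fst : ℝ × L → ℝ) q w
    + gL.inner q.2 (mfderiv (cylModel d) (𝓡 d) (Prod.snd : ℝ × L → L) q v)
        (mfderiv (cylModel d) (𝓡 d) (Prod.snd : ℝ × L → L) q w)

variable {M : Type*} [MetricSpace M] [ChartedSpace (EuclideanSpace ℝ (Fin (d + 1))) M]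
  [RiemannianBundle (fun p : M => TangentSpace (𝓡 (d + 1)) p)]

/-- The pullback `Φ^* g` of the metric of `M` under a map `Φ : ℝ × L → M`. -/
def pullbackMetric (Φ : ℝ × L → M) (q : ℝ × L) (v w : TangentSpace (cylModel d) q) : ℝ :=
  metricTensor (d + 1) (Φ q) (mfderiv (cylModel d) (𝓡 (d + 1)) Φ q v)
    (mfderiv (cylModel d) (𝓡 (d + 1)) Φ q w)

variable (L M) in
/-- The data that exhibit the Riemannian manifold `M` of dimension `d + 1` as asymptotically
cylindrical with cross-section `L`: a metric `gL` on `L`, a rate `δ > 0`, a bounded open set `U` and a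
diffeomorphism `Φ : [0, ∞) × L → M \ U`, smooth up to the boundary together with its inverse, such
that `|∇^k (Φ^* g - g_cyl)| = O(e^{-δ t})` as `t → ∞` for all `k`, with `∇` and `|·|` those of
`g_cyl`. (The values of `Φ` at `t < 0` and of its inverse on `U` play no role.) -/
structure ACylStructure where
  gL : ContMDiffRiemannianMetric (𝓡 d) ∞ (EuclideanSpace ℝ (Fin d))
    (fun x : L => TangentSpace (𝓡 d) x)
  δ : ℝ
  δ_pos : 0 < δ
  U : Set M
  isOpen_U : IsOpen U
  isBounded_U : Bornology.IsBounded U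
  Φ : PartialEquiv (ℝ × L) M
  source_eq : Φ.source = Ici 0 ×ˢ univ
  target_eq : Φ.target = Uᶜ
  contMDiffOn : ContMDiffOn (cylModel d) (𝓡 (d + 1)) ∞ Φ Φ.source
  contMDiffOn_symm : ContMDiffOn (𝓡 (d + 1)) (cylModel d) ∞ Φ.symm Φ.target
  decay : ∀ k : ℕ, ∃ C : ℝ, ∀ᶠ s : ℝ in atTop, ∀ x : L,
    covNorm₂ (cylModel d) (cylBasis d) (cylMetric d gL)
      (fun q v w => pullbackMetric d Φ q v w - cylMetric d gL q v w) k (s, x)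
      ≤ C * Real.exp (-δ * s)

variable {d} in
/-- A cylindrical coordinate function: a smooth extension to `M` of the radial coordinate of the
cylindrical end. -/
structure ACylStructure.IsCylCoord (A : ACylStructure d L M) (t : M → ℝ) : Prop where
  contMDiff : ContMDiff (𝓡 (d + 1)) 𝓘(ℝ, ℝ) ∞ t
  apply_Φ : ∀ s : ℝ, 0 ≤ s → ∀ x : L, t (A.Φ (s, x)) = s

/-- The weighted space `C^k_ε(M)` with respect to the coordinate function `t`: functions `u` of
class `C^k` with `sup_M |e^{ε t} ∇^j u|_g < ∞` for `j = 0, …, k`. -/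
def MemWeighted (t : M → ℝ) (k : ℕ) (ε : ℝ) (u : M → ℝ) : Prop :=
  ContMDiff (𝓡 (d + 1)) 𝓘(ℝ, ℝ) k u ∧
    ∀ j ≤ k, ∃ C : ℝ, ∀ p : M, Real.exp (ε * t p) *
      covNorm₀ (𝓡 (d + 1)) (stdBasis (d + 1)) (metricTensor (d + 1)) u j p ≤ C

end Cylinder

end ACyl

end

/-! Write `w = e^f / (f + c)²`. The inequality is proved by translations, with no spectral theory
and no argument by contradiction. On the end, `f` stays within a bounded distance of `2t`, so `w` is
comparable to the model weight `cylWeight t = e^{2t} / (1 + t²)` (`weight_comparison`). This weight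
at least doubles under `t ↦ t + 1` (`cylWeight_le_half`).

Let `X` be the weighted square integral of `u` over a strip `(T', ∞) × ball` of the end, and let `h`
be the unit axial vector. From `u(y)² ≤ (3/2) u(y + h)² + 3 (u(y + h) - u(y))²` and the doubling of
the weight one gets `X ≤ (3/4) X + C · energy`. The increment is bounded by the integral of the
squared derivative along the segment, and the outward translation maps the strip into itself, so no
boundary term appears. Compact support makes `X` finite, and `(3/4) X` is absorbed
(`IsBilipParam.poincare_end`). Finitely many strips cover the end because the cross-section is
compact.

On the remaining core the weight is bounded above, so control of the plain `L²`-norm by the energy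
suffices. The end provides this control on the open set `{t > T'}`. The same translation inequality,
inside a chart ball, shows that the set of points having a neighbourhood with such control is closed
(`energyControls_nhds_of_mem_closure`). It is also open and nonempty, so it is all of the connected
`M`, and a compact core is covered by finitely many such neighbourhoods. The core is compact by the
Hopf–Rinow theorem (`ApproxLength.isCompact_closedBall`).

To work with Lebesgue measure and straight segments, everything is read through parametrizations
with bounded distortion (`IsBilipParam`). For these the Riemannian volume is `√(det g_ij) dy`
(`volumeMeasure_restrict_image`), with a density bounded above and below. On the end, the decay of
`Φ^*g - g_cyl` gives distortion bounds uniform along the axis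
(`ACylStructure.exists_isBilipParam_endParam`). -/

noncomputable section

namespace ACyl

set_option linter.unusedSectionVars false

/-! ### Compactness of closed balls in complete length spaces -/

section HopfRinow

variable {X : Type*} [MetricSpace X]

/-- A metric space is an approximate length space if every pair of points can be joined through
almost optimal intermediate points at any prescribed distance. -/
def ApproxLength (X : Type*) [MetricSpace X] : Prop :=
  ∀ x y : X, ∀ r : ℝ, 0 ≤ r → r ≤ dist x y → ∀ ε : ℝ, 0 < ε →
    ∃ z : X, dist x z ≤ r ∧ dist z y ≤ dist x y - r + ε

/-- Every point of the ball of radius `R` lies within `2η` of the compact ball of radius `R - η`. A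
finite `ε/4`-net of the latter is therefore an `ε`-net of the former, as `2η ≤ ε/2`. -/
theorem ApproxLength.isCompact_closedBall_of_lt [CompleteSpace X] (h : ApproxLength X) (x : X)
    {R : ℝ} (hR : 0 < R) (hc : ∀ r, 0 ≤ r → r < R → IsCompact (Metric.closedBall x r)) :
    IsCompact (Metric.closedBall x R) := by
  refine TotallyBounded.isCompact_of_isClosed ?_ Metric.isClosed_closedBall
  rw [Metric.totallyBounded_iff]
  intro ε hε
  set η := min (ε / 4) (R / 2)
  have hη : 0 < η := by positivity
  have h1 : η ≤ ε / 4 := min_le_left _ _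
  have h2 : η ≤ R / 2 := min_le_right _ _
  have hK := hc (R - η) (by linarith) (by linarith)
  obtain ⟨s, hs, hsub⟩ := Metric.totallyBounded_iff.1 hK.totallyBounded (ε / 4) (by linarith)
  refine ⟨s, hs, fun y hy => ?_⟩
  rw [Metric.mem_closedBall, dist_comm] at hy
  obtain ⟨z, hz, hzy⟩ : ∃ z : X, dist x z ≤ R - η ∧ dist z y ≤ 2 * η := by
    rcases le_total (R - η) (dist x y) with hle | hle
    · obtain ⟨z, hz, hzy⟩ := h x y (R - η) (by linarith) hle η hη
      exact ⟨z, hz, by linarith⟩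
    · exact ⟨y, hle, by simp; linarith⟩
  have hz' : z ∈ Metric.closedBall x (R - η) := by
    rw [Metric.mem_closedBall, dist_comm]; exact hz
  obtain ⟨a, ha, haz⟩ := mem_iUnion₂.1 (hsub hz')
  refine mem_iUnion₂.2 ⟨a, ha, ?_⟩
  rw [Metric.mem_ball] at haz ⊢
  have := dist_triangle_left y a z
  linarith

/-- The Hopf–Rinow theorem for complete locally compact length spaces. -/
theorem ApproxLength.isCompact_closedBall [CompleteSpace X] [LocallyCompactSpace X]
    (h : ApproxLength X) (x : X) (R : ℝ) : IsCompact (Metric.closedBall x R) := by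
  by_contra hR
  set S : Set ℝ := {r | 0 ≤ r ∧ IsCompact (Metric.closedBall x r)} with hS
  have hmono : ∀ {r r'}, r ≤ r' → IsCompact (Metric.closedBall x r') →
      IsCompact (Metric.closedBall x r) := fun hr hc =>
    hc.of_isClosed_subset Metric.isClosed_closedBall (Metric.closedBall_subset_closedBall hr)
  have h0 : (0 : ℝ) ∈ S := ⟨le_rfl, by simp⟩
  have hbdd : BddAbove S := ⟨R, fun r hr => by
    by_contra hlt
    exact hR (hmono (not_le.1 hlt).le hr.2)⟩
  set ρ := sSup S
  have hρ0 : 0 ≤ ρ := le_csSup hbdd h0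
  have hlt : ∀ r, 0 ≤ r → r < ρ → IsCompact (Metric.closedBall x r) := fun r _ hr => by
    obtain ⟨r', hr', hrr'⟩ := exists_lt_of_lt_csSup ⟨0, h0⟩ hr
    exact hmono hrr'.le hr'.2
  have hρ : IsCompact (Metric.closedBall x ρ) := by
    rcases hρ0.eq_or_lt with h' | h'
    · rw [← h']; simp
    · exact h.isCompact_closedBall_of_lt x h' hlt
  -- Local compactness gives a compact thickening of the ball of radius `ρ`. It contains the ball of
  -- radius `ρ + δ/2`, which contradicts the choice of `ρ` as a supremum.
  obtain ⟨δ, hδ, hcomp⟩ := hρ.exists_isCompact_cthickening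
  have hmem : ρ + δ / 2 ∈ S := by
    refine ⟨by positivity, hcomp.of_isClosed_subset Metric.isClosed_closedBall fun y hy => ?_⟩
    rw [Metric.mem_closedBall, dist_comm] at hy
    rcases le_total ρ (dist x y) with hle | hle
    · obtain ⟨z, hz, hzy⟩ := h x y ρ hρ0 hle (δ / 2) (by positivity)
      refine Metric.mem_cthickening_of_dist_le y z δ _ (by rwa [Metric.mem_closedBall, dist_comm]) ?_
      rw [dist_comm]; linarith
    · exact Metric.self_subset_cthickening _ (by rwa [Metric.mem_closedBall, dist_comm])
  have := le_csSup hbdd hmem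
  linarith

end HopfRinow

/-! ### Riemannian distance and almost minimizing paths -/

section Length

open Manifold

/-- A Riemannian manifold is an approximate length space. -/
theorem approxLength_of_isRiemannianManifold
    {E : Type*} [NormedAddCommGroup E] [NormedSpace ℝ E] {H : Type*} [TopologicalSpace H]
    (I : ModelWithCorners ℝ E H) {M : Type*} [MetricSpace M] [ChartedSpace H M]
    [RiemannianBundle (fun x : M => TangentSpace I x)] [IsRiemannianManifold I M] :
    ApproxLength M := by
  intro x y r hr hrd ε hε
  have hlt : riemannianEDist I x y < ENNReal.ofReal (dist x y + ε) := by
    rw [← IsRiemannianManifold.out (I := I) x y, edist_dist]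
    exact (ENNReal.ofReal_lt_ofReal_iff (by positivity)).2 (by linarith)
  obtain ⟨γ, h0, h1, hγ, hlen⟩ := exists_lt_of_riemannianEDist_lt hlt
  -- The intermediate point is taken on an almost minimizing path, where the distance from `x`
  -- equals `r`. What is left of the path is then short enough.
  have hcont : ContinuousOn (fun s => dist x (γ s)) (Icc 0 1) :=
    (continuous_const.dist continuous_id).comp_continuousOn hγ.continuousOn
  obtain ⟨s, hs, hsr⟩ : r ∈ (fun s => dist x (γ s)) '' Icc 0 1 :=
    intermediate_value_Icc zero_le_one hcont (by simp [h0, h1, hr, hrd])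
  have hsr : dist x (γ s) = r := hsr
  refine ⟨γ s, hsr.le, ?_⟩
  have ha : riemannianEDist I x (γ s) ≤ pathELength I γ 0 s :=
    riemannianEDist_le_pathELength (hγ.mono (Icc_subset_Icc_right hs.2)) h0 rfl hs.1
  have hb : riemannianEDist I (γ s) y ≤ pathELength I γ s 1 :=
    riemannianEDist_le_pathELength (hγ.mono (Icc_subset_Icc_left hs.1)) rfl h1 hs.2
  have hab := (add_le_add ha hb).trans_lt (by rwa [pathELength_add hs.1 hs.2])
  rw [← IsRiemannianManifold.out (I := I), ← IsRiemannianManifold.out (I := I), edist_dist,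
    edist_dist, ← ENNReal.ofReal_add dist_nonneg dist_nonneg,
    ENNReal.ofReal_lt_ofReal_iff (by positivity), hsr] at hab
  linarith

end Length

/-! ### Determinants and quadratic form bounds -/

section Determinant

variable {m : ℕ}

/-- The determinant is the product of the eigenvalues, and each eigenvalue is the value of the
quadratic form at a unit eigenvector. -/
theorem pow_le_det_of_quadratic_bounds {A : Matrix (Fin m) (Fin m) ℝ} (hA : A.IsHermitian)
    {k K : ℝ} (hk : 0 ≤ k) (hlow : ∀ v : Fin m → ℝ, k * (v ⬝ᵥ v) ≤ v ⬝ᵥ A.mulVec v)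
    (hup : ∀ v : Fin m → ℝ, v ⬝ᵥ A.mulVec v ≤ K * (v ⬝ᵥ v)) :
    k ^ m ≤ A.det ∧ A.det ≤ K ^ m := by
  have key : ∀ i, k ≤ hA.eigenvalues i ∧ hA.eigenvalues i ≤ K := by
    intro i
    have h1 : (hA.eigenvectorBasis i).ofLp ⬝ᵥ (hA.eigenvectorBasis i).ofLp = 1 := by
      have h := hA.eigenvectorBasis.orthonormal.1 i
      have h' := EuclideanSpace.real_norm_sq_eq (hA.eigenvectorBasis i)
      rw [h] at h'
      simp only [dotProduct, ← pow_two]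
      linarith
    have h2 := hA.eigenvalues_eq i
    simp only [star_trivial, RCLike.re_to_real] at h2
    have h3 := hlow (hA.eigenvectorBasis i).ofLp
    have h4 := hup (hA.eigenvectorBasis i).ofLp
    rw [h1, ← h2] at h3 h4
    constructor <;> linarith
  have hdet : A.det = ∏ i, hA.eigenvalues i := by
    simpa using hA.det_eq_prod_eigenvalues
  rw [hdet]
  constructor
  · simpa using Finset.prod_le_prod (s := Finset.univ) (f := fun _ : Fin m => k)
      (fun _ _ => hk) (fun i _ => (key i).1)
  · simpa using Finset.prod_le_prod (s := Finset.univ) (g := fun _ : Fin m => K)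
      (fun i _ => hk.trans (key i).1) (fun i _ => (key i).2)

end Determinant

/-! ### The translation inequality in Euclidean coordinates -/

section Translation

variable {E : Type*} [NormedAddCommGroup E] [NormedSpace ℝ E]

/-- The square of an increment is at most the mean square of the derivative. -/
theorem sq_sub_le_lintegral_of_hasDerivAt {g g' : ℝ → ℝ}
    (hg : ∀ s ∈ Icc (0 : ℝ) 1, HasDerivAt g (g' s) s) (hg' : ContinuousOn g' (Icc 0 1)) :
    ENNReal.ofReal ((g 1 - g 0) ^ 2) ≤ ∫⁻ s in Ioc (0 : ℝ) 1, ENNReal.ofReal (g' s ^ 2) := by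
  have hint : IntervalIntegrable g' volume 0 1 :=
    ContinuousOn.intervalIntegrable (by rwa [uIcc_of_le zero_le_one])
  have hint2 : IntervalIntegrable (fun s => g' s ^ 2) volume 0 1 :=
    ContinuousOn.intervalIntegrable (by rw [uIcc_of_le zero_le_one]; exact hg'.pow 2)
  have hftc := intervalIntegral.integral_eq_sub_of_hasDerivAt
    (f := g) (f' := g') (a := 0) (b := 1) (by rwa [uIcc_of_le zero_le_one]) hint
  set μ := g 1 - g 0
  have hle : μ ^ 2 ≤ ∫ s in (0 : ℝ)..1, g' s ^ 2 := by
    -- `μ` is the mean of `g'`, so nonnegativity of the variance is the required Jensen inequality.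
    have hnn : 0 ≤ ∫ s in (0 : ℝ)..1, (g' s - μ) ^ 2 :=
      intervalIntegral.integral_nonneg zero_le_one fun _ _ => sq_nonneg _
    have hexp : ∫ s in (0 : ℝ)..1, (g' s - μ) ^ 2
        = (∫ s in (0 : ℝ)..1, g' s ^ 2) - 2 * μ * (∫ s in (0 : ℝ)..1, g' s) + μ ^ 2 := by
      rw [← intervalIntegral.integral_const_mul, ← intervalIntegral.integral_sub hint2
        (hint.const_mul _)]
      have : μ ^ 2 = ∫ s in (0 : ℝ)..1, μ ^ 2 := by simp
      rw [this, ← intervalIntegral.integral_add (hint2.sub (hint.const_mul _)) (by simp)]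
      congr 1; ext s; ring
    rw [hexp, hftc] at hnn
    nlinarith
  rw [intervalIntegral.integral_of_le zero_le_one] at hle
  rw [← ofReal_integral_eq_lintegral_ofReal
    ((intervalIntegrable_iff_integrableOn_Ioc_of_le zero_le_one).1 hint2)
    (Eventually.of_forall fun _ => sq_nonneg _)]
  exact ENNReal.ofReal_le_ofReal hle

theorem sq_sub_le_lintegral_of_contDiffOn {Ω : Set E} (hΩ : IsOpen Ω) {v : E → ℝ}
    (hv : ContDiffOn ℝ 1 v Ω) {y h : E} (hy : ∀ s ∈ Icc (0 : ℝ) 1, y + s • h ∈ Ω) :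
    ENNReal.ofReal ((v (y + h) - v y) ^ 2) ≤
      ∫⁻ s in Ioc (0 : ℝ) 1, ENNReal.ofReal (fderiv ℝ v (y + s • h) h ^ 2) := by
  have hline : ∀ s : ℝ, HasDerivAt (fun s : ℝ => y + s • h) h s := fun s => by
    simpa using ((hasDerivAt_id s).smul_const h).const_add y
  have hd := sq_sub_le_lintegral_of_hasDerivAt (g := fun s => v (y + s • h))
    (g' := fun s => fderiv ℝ v (y + s • h) h) (fun s hs => by
      have hdiff : DifferentiableAt ℝ v (y + s • h) :=
        (hv.differentiableOn one_ne_zero).differentiableAt (hΩ.mem_nhds (hy s hs))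
      exact hdiff.hasFDerivAt.comp_hasDerivAt s (hline s)) (by
      have hc : ContinuousOn (fun s : ℝ => fderiv ℝ v (y + s • h)) (Icc 0 1) :=
        (hv.continuousOn_fderiv_of_isOpen hΩ le_rfl).comp (by fun_prop) hy
      exact hc.clm_apply continuousOn_const)
  simpa using hd

variable [MeasurableSpace E] [BorelSpace E] [FiniteDimensional ℝ E]

/-- If the increments of `v` along `h` are controlled by the mean of `G` along the segments, then
the weighted `L²`-norm of `v` on `B` is controlled by that on `B + h` and by `G`. -/
theorem lintegral_sq_le_translate (μ : Measure E) [μ.IsAddHaarMeasure]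
    {B B' C : Set E} {h : E} (hB : MeasurableSet B)
    {v : E → ℝ} {W G : E → ENNReal} (hW : Measurable W) (hv : AEMeasurable v (μ.restrict B'))
    (hG : Measurable G) (hB' : MeasurableSet B') (hC : MeasurableSet C) {θ c a b : ℝ}
    (ha : 0 ≤ a) (hb : 0 ≤ b)
    (hab : ∀ p q : ℝ, p ^ 2 ≤ a * q ^ 2 + b * (q - p) ^ 2)
    (hBB' : ∀ y ∈ B, y + h ∈ B') (hBC : ∀ y ∈ B, ∀ s ∈ Icc (0 : ℝ) 1, y + s • h ∈ C)
    (hWθ : ∀ y ∈ B, W y ≤ ENNReal.ofReal θ * W (y + h))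
    (hWc : ∀ y ∈ B, ∀ s ∈ Icc (0 : ℝ) 1, W y ≤ ENNReal.ofReal c * W (y + s • h))
    (hvG : ∀ y ∈ B, ENNReal.ofReal ((v (y + h) - v y) ^ 2) ≤ ∫⁻ s in Ioc (0 : ℝ) 1, G (y + s • h)) :
    ∫⁻ y in B, W y * ENNReal.ofReal (v y ^ 2) ∂μ ≤
      ENNReal.ofReal (a * θ) * ∫⁻ y in B', W y * ENNReal.ofReal (v y ^ 2) ∂μ
        + ENNReal.ofReal (b * c) * ∫⁻ y in C, W y * G y ∂μ := by
  -- Extension by zero turns all integrals into integrals over `E`, where translation invariance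
  -- applies.
  set F : E → ENNReal := B'.indicator fun y => W y * ENNReal.ofReal (v y ^ 2) with hF
  have hFm : AEMeasurable F μ := by
    rw [hF, aemeasurable_indicator_iff hB']
    exact hW.aemeasurable.mul (hv.pow_const 2).ennreal_ofReal
  set K : E → ENNReal := C.indicator fun y => W y * G y with hK
  have hKm : Measurable K := (hW.mul hG).indicator hC
  have h1 : ∀ y ∈ B, W y * ENNReal.ofReal (v y ^ 2) ≤
      ENNReal.ofReal (a * θ) * F (y + h)
        + ENNReal.ofReal (b * c) * ∫⁻ s in Ioc (0 : ℝ) 1, K (y + s • h) := by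
    intro y hy
    have e1 : ENNReal.ofReal (v y ^ 2) ≤ ENNReal.ofReal a * ENNReal.ofReal (v (y + h) ^ 2)
        + ENNReal.ofReal b * ENNReal.ofReal ((v (y + h) - v y) ^ 2) := by
      rw [← ENNReal.ofReal_mul ha, ← ENNReal.ofReal_mul hb, ← ENNReal.ofReal_add (by positivity)
        (by positivity)]
      exact ENNReal.ofReal_le_ofReal (hab _ _)
    have e2 : W y * ENNReal.ofReal ((v (y + h) - v y) ^ 2) ≤
        ENNReal.ofReal c * ∫⁻ s in Ioc (0 : ℝ) 1, K (y + s • h) := by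
      calc W y * ENNReal.ofReal ((v (y + h) - v y) ^ 2)
          ≤ W y * ∫⁻ s in Ioc (0 : ℝ) 1, G (y + s • h) := by gcongr; exact hvG y hy
        _ = ∫⁻ s in Ioc (0 : ℝ) 1, W y * G (y + s • h) :=
            (lintegral_const_mul _ (by fun_prop)).symm
        _ ≤ ∫⁻ s in Ioc (0 : ℝ) 1, ENNReal.ofReal c * K (y + s • h) := by
            refine setLIntegral_mono' measurableSet_Ioc fun s hs => ?_
            have hs' := Ioc_subset_Icc_self hs
            rw [hK, indicator_of_mem (hBC y hy s hs'), ← mul_assoc]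
            gcongr
            exact hWc y hy s hs'
        _ = _ := lintegral_const_mul _ (by fun_prop)
    calc W y * ENNReal.ofReal (v y ^ 2)
        ≤ W y * (ENNReal.ofReal a * ENNReal.ofReal (v (y + h) ^ 2)
          + ENNReal.ofReal b * ENNReal.ofReal ((v (y + h) - v y) ^ 2)) := by gcongr
      _ = ENNReal.ofReal a * (W y * ENNReal.ofReal (v (y + h) ^ 2))
          + ENNReal.ofReal b * (W y * ENNReal.ofReal ((v (y + h) - v y) ^ 2)) := by ring
      _ ≤ ENNReal.ofReal a * ((ENNReal.ofReal θ * W (y + h)) * ENNReal.ofReal (v (y + h) ^ 2))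
          + ENNReal.ofReal b * (ENNReal.ofReal c * ∫⁻ s in Ioc (0 : ℝ) 1, K (y + s • h)) := by
          gcongr; exact hWθ y hy
      _ = _ := by
          rw [hF, indicator_of_mem (hBB' y hy), ENNReal.ofReal_mul ha, ENNReal.ofReal_mul hb]
          ring
  have hFh : AEMeasurable (fun y => F (y + h)) μ :=
    hFm.comp_quasiMeasurePreserving (measurePreserving_add_right μ h).quasiMeasurePreserving
  -- By Tonelli the `y`-integral can be done first. It does not depend on `s`, and `s` runs over an
  -- interval of length one.
  have hswap : ∫⁻ y, (∫⁻ s in Ioc (0 : ℝ) 1, K (y + s • h)) ∂μ = ∫⁻ y, K y ∂μ := by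
    rw [lintegral_lintegral_swap]
    · simp only [lintegral_add_right_eq_self (μ := μ) K]
      simp
    · exact (hKm.comp (by fun_prop : Measurable fun z : E × ℝ => z.1 + z.2 • h)).aemeasurable
  calc ∫⁻ y in B, W y * ENNReal.ofReal (v y ^ 2) ∂μ
      ≤ ∫⁻ y in B, (ENNReal.ofReal (a * θ) * F (y + h)
        + ENNReal.ofReal (b * c) * ∫⁻ s in Ioc (0 : ℝ) 1, K (y + s • h)) ∂μ :=
        setLIntegral_mono' hB h1
    _ ≤ ∫⁻ y, (ENNReal.ofReal (a * θ) * F (y + h)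
        + ENNReal.ofReal (b * c) * ∫⁻ s in Ioc (0 : ℝ) 1, K (y + s • h)) ∂μ :=
        setLIntegral_le_lintegral _ _
    _ = ENNReal.ofReal (a * θ) * ∫⁻ y, F (y + h) ∂μ
        + ENNReal.ofReal (b * c) * ∫⁻ y, (∫⁻ s in Ioc (0 : ℝ) 1, K (y + s • h)) ∂μ := by
        rw [lintegral_add_left' (hFh.const_mul _), lintegral_const_mul' _ _ ENNReal.ofReal_ne_top,
          lintegral_const_mul' _ _ ENNReal.ofReal_ne_top]
    _ = _ := by
        rw [hswap, lintegral_add_right_eq_self F h, hF, hK, lintegral_indicator hB',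
          lintegral_indicator hC]

end Translation

/-! ### Continuity of pulled back metrics -/

section PullbackContinuity

variable {F : Type*} [NormedAddCommGroup F] [NormedSpace ℝ F]
  {E : Type*} [NormedAddCommGroup E] [NormedSpace ℝ E]
  {H : Type*} [TopologicalSpace H] {I : ModelWithCorners ℝ E H}
  {N : Type*} [TopologicalSpace N] [ChartedSpace H N] [IsManifold I 1 N]

theorem continuousOn_mfderiv_apply {ψ : F → N} {Ω : Set F} (hΩ : IsOpen Ω)
    (hψ : ContMDiffOn 𝓘(ℝ, F) I 1 ψ Ω) (v : F) :
    ContinuousOn (fun y => (⟨ψ y, mfderiv 𝓘(ℝ, F) I ψ y v⟩ : TangentBundle I N)) Ω := by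
  have h1 := hψ.continuousOn_tangentMapWithin le_rfl hΩ.uniqueMDiffOn
  have h2 : Continuous (fun y : F => (⟨y, v⟩ : TangentBundle 𝓘(ℝ, F) F)) :=
    (tangentBundleModelSpaceHomeomorph 𝓘(ℝ, F)).symm.continuous.comp
      (by fun_prop : Continuous fun y : F => ((y, v) : F × F))
  refine (h1.comp h2.continuousOn (fun y hy => hy)).congr fun y hy => ?_
  simp only [Function.comp, tangentMapWithin, mfderivWithin_of_isOpen hΩ hy]

variable [RiemannianBundle (fun p : N => TangentSpace I p)]
  [IsContinuousRiemannianBundle E (fun p : N => TangentSpace I p)]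

theorem continuousOn_inner_mfderiv {ψ : F → N} {Ω : Set F} (hΩ : IsOpen Ω)
    (hψ : ContMDiffOn 𝓘(ℝ, F) I 1 ψ Ω) (v w : F) :
    ContinuousOn (fun y => inner ℝ (mfderiv 𝓘(ℝ, F) I ψ y v) (mfderiv 𝓘(ℝ, F) I ψ y w)) Ω :=
  (continuousOn_mfderiv_apply hΩ hψ v).inner_bundle (continuousOn_mfderiv_apply hΩ hψ w)

end PullbackContinuity

/-! ### Gram matrices of parametrizations -/

section Gram

variable {m : ℕ} {M : Type*} [TopologicalSpace M] [ChartedSpace (EuclideanSpace ℝ (Fin m)) M]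
  [RiemannianBundle (fun p : M => TangentSpace (𝓡 m) p)]

/-- The Gram matrix of the coordinate vectors of a parametrization. -/
def gramMatrix (ψ : EuclideanSpace ℝ (Fin m) → M) (y : EuclideanSpace ℝ (Fin m)) :
    Matrix (Fin m) (Fin m) ℝ :=
  Matrix.of fun i j => inner ℝ (mfderiv (𝓡 m) (𝓡 m) ψ y (stdBasis m i))
    (mfderiv (𝓡 m) (𝓡 m) ψ y (stdBasis m j))

theorem isHermitian_gramMatrix (ψ : EuclideanSpace ℝ (Fin m) → M) (y : EuclideanSpace ℝ (Fin m)) :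
    (gramMatrix ψ y).IsHermitian := by
  ext i j
  simp [gramMatrix, real_inner_comm]

theorem dotProduct_gramMatrix_mulVec (ψ : EuclideanSpace ℝ (Fin m) → M)
    (y v w : EuclideanSpace ℝ (Fin m)) :
    v.ofLp ⬝ᵥ (gramMatrix ψ y).mulVec w.ofLp
      = inner ℝ (mfderiv (𝓡 m) (𝓡 m) ψ y v) (mfderiv (𝓡 m) (𝓡 m) ψ y w) := by
  have hv : ∀ v : EuclideanSpace ℝ (Fin m), mfderiv (𝓡 m) (𝓡 m) ψ y v
      = ∑ i, v i • mfderiv (𝓡 m) (𝓡 m) ψ y (stdBasis m i) := by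
    intro v
    have h : v = ∑ i, v i • stdBasis m i := by
      simpa using ((EuclideanSpace.basisFun (Fin m) ℝ).sum_repr v).symm
    conv_lhs => rw [h]
    exact (map_sum (mfderiv (𝓡 m) (𝓡 m) ψ y) _ _).trans
      (Finset.sum_congr rfl fun i _ => map_smul (mfderiv (𝓡 m) (𝓡 m) ψ y) _ _)
  rw [hv v, hv w, sum_inner]
  simp only [dotProduct, Matrix.mulVec, gramMatrix, Matrix.of_apply, inner_sum, inner_smul_left,
    inner_smul_right, Finset.mul_sum]
  refine Finset.sum_congr rfl fun i _ => Finset.sum_congr rfl fun j _ => ?_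
  simp only [conj_trivial]; ring

theorem det_gramMatrix_bounds {ψ : EuclideanSpace ℝ (Fin m) → M} {y : EuclideanSpace ℝ (Fin m)}
    {k K : ℝ} (hk : 0 ≤ k)
    (hlow : ∀ v : EuclideanSpace ℝ (Fin m), k * ‖v‖ ^ 2 ≤ ‖mfderiv (𝓡 m) (𝓡 m) ψ y v‖ ^ 2)
    (hup : ∀ v : EuclideanSpace ℝ (Fin m), ‖mfderiv (𝓡 m) (𝓡 m) ψ y v‖ ^ 2 ≤ K * ‖v‖ ^ 2) :
    k ^ m ≤ (gramMatrix ψ y).det ∧ (gramMatrix ψ y).det ≤ K ^ m := by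
  have hn : ∀ v : Fin m → ℝ, v ⬝ᵥ v = ‖(WithLp.toLp 2 v : EuclideanSpace ℝ (Fin m))‖ ^ 2 := by
    intro v
    rw [EuclideanSpace.real_norm_sq_eq]
    simp [dotProduct, pow_two]
  have hq : ∀ v : Fin m → ℝ, v ⬝ᵥ (gramMatrix ψ y).mulVec v
      = ‖mfderiv (𝓡 m) (𝓡 m) ψ y (WithLp.toLp 2 v)‖ ^ 2 := by
    intro v
    rw [← real_inner_self_eq_norm_sq]
    exact dotProduct_gramMatrix_mulVec ψ y (WithLp.toLp 2 v) (WithLp.toLp 2 v)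
  refine pow_le_det_of_quadratic_bounds (isHermitian_gramMatrix ψ y) hk (fun v => ?_) fun v => ?_
  · rw [hn, hq]; exact hlow _
  · rw [hn, hq]; exact hup _

theorem continuousOn_gramMatrix [IsManifold (𝓡 m) 1 M]
    [IsContinuousRiemannianBundle (EuclideanSpace ℝ (Fin m)) (fun p : M => TangentSpace (𝓡 m) p)]
    {ψ : EuclideanSpace ℝ (Fin m) → M}
    {Ω : Set (EuclideanSpace ℝ (Fin m))} (hΩ : IsOpen Ω) (hψ : ContMDiffOn (𝓡 m) (𝓡 m) 1 ψ Ω) :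
    ContinuousOn (gramMatrix ψ) Ω :=
  continuousOn_pi.2 fun i => continuousOn_pi.2 fun j =>
    continuousOn_inner_mfderiv hΩ hψ (stdBasis m i) (stdBasis m j)

/-- The Gram matrix transforms as `Bᵀ G B`, with `B` the Jacobian matrix of `T`. The square root of
its determinant thus picks up exactly the factor `|det B|` of the change of variables formula. -/
theorem gramMatrix_comp {ψ : EuclideanSpace ℝ (Fin m) → M}
    {T : EuclideanSpace ℝ (Fin m) → EuclideanSpace ℝ (Fin m)} {y : EuclideanSpace ℝ (Fin m)}
    {D : EuclideanSpace ℝ (Fin m) →L[ℝ] EuclideanSpace ℝ (Fin m)} (hT : HasFDerivAt T D y)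
    (hψ : MDifferentiableAt (𝓡 m) (𝓡 m) ψ (T y)) :
    (gramMatrix (ψ ∘ T) y).det = D.det ^ 2 * (gramMatrix ψ (T y)).det := by
  set B : Matrix (Fin m) (Fin m) ℝ :=
    LinearMap.toMatrix (stdBasis m) (stdBasis m) (D : _ →ₗ[ℝ] _) with hB
  have hcol : ∀ i, B.col i = (D (stdBasis m i)).ofLp := by
    intro i; ext j
    simp [hB, LinearMap.toMatrix_apply, Matrix.col]
  have hmat : gramMatrix (ψ ∘ T) y = B.transpose * gramMatrix ψ (T y) * B := by
    ext i j
    have h1 : mfderiv (𝓡 m) (𝓡 m) (ψ ∘ T) y = (mfderiv (𝓡 m) (𝓡 m) ψ (T y)).comp D := by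
      rw [mfderiv_comp y hψ hT.differentiableAt.mdifferentiableAt, mfderiv_eq_fderiv, hT.fderiv]
      rfl
    have h2 : gramMatrix (ψ ∘ T) y i j = inner ℝ
        (mfderiv (𝓡 m) (𝓡 m) ψ (T y) (D (stdBasis m i)))
        (mfderiv (𝓡 m) (𝓡 m) ψ (T y) (D (stdBasis m j))) := by
      simp only [gramMatrix, Matrix.of_apply]
      rw [h1]; rfl
    rw [h2, ← dotProduct_gramMatrix_mulVec, ← hcol, ← hcol, Matrix.mul_assoc, Matrix.mul_apply]
    rfl
  have hdet : D.det = B.det := by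
    rw [hB, LinearMap.det_toMatrix]
  rw [hmat, Matrix.det_mul, Matrix.det_mul, Matrix.det_transpose, hdet]
  ring

end Gram

theorem measurableSet_preimage_inter_of_continuousOn {X Y : Type*} [TopologicalSpace X]
    [MeasurableSpace X] [OpensMeasurableSpace X] [TopologicalSpace Y] [MeasurableSpace Y]
    [BorelSpace Y] {f : X → Y} {Ω : Set X} (hf : ContinuousOn f Ω) (hΩ : MeasurableSet Ω)
    {B : Set Y} (hB : MeasurableSet B) : MeasurableSet (f ⁻¹' B ∩ Ω) := by
  have h := (hf.domRestrict.measurable hB)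
  rw [inter_comm, ← Subtype.image_preimage_coe]
  exact hΩ.subtype_image h

/-! ### The Riemannian volume in an arbitrary parametrization -/

section Volume

variable {m : ℕ} {M : Type*} [TopologicalSpace M] [T2Space M]
  [MeasurableSpace M] [BorelSpace M]
  [ChartedSpace (EuclideanSpace ℝ (Fin m)) M] [IsManifold (𝓡 m) 1 M]
  [RiemannianBundle (fun p : M => TangentSpace (𝓡 m) p)]
  [IsContinuousRiemannianBundle (EuclideanSpace ℝ (Fin m)) (fun p : M => TangentSpace (𝓡 m) p)]

/-- The Riemannian volume measure of a chart domain. -/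
def chartMeasure (x : M) : Measure M :=
  Measure.map (extChartAt (𝓡 m) x).symm
    (((volume : Measure (EuclideanSpace ℝ (Fin m))).withDensity fun y =>
      ENNReal.ofReal √(coordMatrix (𝓡 m) (stdBasis m) (metricTensor m) x y).det).restrict
      (extChartAt (𝓡 m) x).target)


theorem aemeasurable_extChartAt_symm (x : M) (μ : Measure (EuclideanSpace ℝ (Fin m))) :
    AEMeasurable (extChartAt (𝓡 m) x).symm (μ.restrict (extChartAt (𝓡 m) x).target) :=
  (continuousOn_extChartAt_symm x).aemeasurable (isOpen_extChartAt_target x).measurableSet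

theorem chartMeasure_apply {x : M} {S : Set M} (hS : MeasurableSet S) :
    chartMeasure (m := m) x S = ∫⁻ y in (extChartAt (𝓡 m) x).symm ⁻¹' S ∩ (extChartAt (𝓡 m) x).target,
      ENNReal.ofReal √(gramMatrix (extChartAt (𝓡 m) x).symm y).det := by
  have ht := (isOpen_extChartAt_target (I := 𝓡 m) x).measurableSet
  rw [chartMeasure, Measure.map_apply_of_aemeasurable (aemeasurable_extChartAt_symm x _) hS,
    Measure.restrict_apply₀' ht.nullMeasurableSet, withDensity_apply']
  rfl

theorem chartMeasure_inter_source {x : M} {S : Set M} (hS : MeasurableSet S) :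
    chartMeasure (m := m) x S = chartMeasure (m := m) x (S ∩ (extChartAt (𝓡 m) x).source) := by
  rw [chartMeasure_apply hS,
    chartMeasure_apply (hS.inter (isOpen_extChartAt_source x).measurableSet)]
  congr 2
  ext y
  simp only [mem_inter_iff, mem_preimage]
  exact ⟨fun h => ⟨⟨h.1, (extChartAt (𝓡 m) x).map_target h.2⟩, h.2⟩, fun h => ⟨h.1.1, h.2⟩⟩

theorem gramMatrix_congr {ψ ψ' : EuclideanSpace ℝ (Fin m) → M} {y : EuclideanSpace ℝ (Fin m)}
    (h : ψ =ᶠ[𝓝 y] ψ') : gramMatrix ψ y = gramMatrix ψ' y := by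
  -- The base points `ψ y` and `ψ' y` are only propositionally equal, so the tangent vectors are
  -- compared in the model space.
  have aux : ∀ (p p' : M) (_ : p = p') (a b a' b' : EuclideanSpace ℝ (Fin m)), a = a' → b = b' →
      metricTensor m p a b = metricTensor m p' a' b' := by
    rintro p _ rfl a b _ _ rfl rfl; rfl
  have hD : ∀ v : EuclideanSpace ℝ (Fin m), (mfderiv (𝓡 m) (𝓡 m) ψ y v : EuclideanSpace ℝ (Fin m))
      = mfderiv (𝓡 m) (𝓡 m) ψ' y v := fun v =>
    congrArg (fun D : EuclideanSpace ℝ (Fin m) →L[ℝ] EuclideanSpace ℝ (Fin m) => D v)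
      (h.mfderiv_eq (I := 𝓡 m) (I' := 𝓡 m))
  ext i j
  exact aux _ _ h.self_of_nhds _ _ _ _ (hD (stdBasis m i)) (hD (stdBasis m j))

/-- The volume of a parametrized subset of a chart domain. -/
theorem chartMeasure_image {ψ : EuclideanSpace ℝ (Fin m) → M} {Ω A : Set (EuclideanSpace ℝ (Fin m))}
    (hΩ : IsOpen Ω) (hψ : ContMDiffOn (𝓡 m) (𝓡 m) 1 ψ Ω) (hinj : InjOn ψ Ω)
    (hA : MeasurableSet A) (hAΩ : A ⊆ Ω) {x : M} (hx : ψ '' A ⊆ (extChartAt (𝓡 m) x).source) :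
    chartMeasure (m := m) x (ψ '' A) = ∫⁻ y in A, ENNReal.ofReal √(gramMatrix ψ y).det := by
  set e := extChartAt (𝓡 m) x
  have hmeas : MeasurableSet (ψ '' A) :=
    hA.image_of_continuousOn_injOn (hψ.continuousOn.mono hAΩ) (hinj.mono hAΩ)
  -- The transition map from `ψ` to the chart. Its Jacobian in the change of variables formula is
  -- the one supplied by `gramMatrix_comp`.
  set T : EuclideanSpace ℝ (Fin m) → EuclideanSpace ℝ (Fin m) := e ∘ ψ with hT
  have hset : e.symm ⁻¹' (ψ '' A) ∩ e.target = T '' A := by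
    ext z
    constructor
    · rintro ⟨⟨y, hy, hyz⟩, hz⟩
      exact ⟨y, hy, by simp only [hT, Function.comp, hyz]; exact e.right_inv hz⟩
    · rintro ⟨y, hy, rfl⟩
      have hs := hx (mem_image_of_mem ψ hy)
      refine ⟨?_, e.map_source hs⟩
      simp only [mem_preimage, hT, Function.comp, e.left_inv hs]
      exact mem_image_of_mem ψ hy
  have hinjT : InjOn T A := fun y hy y' hy' h =>
    hinj (hAΩ hy) (hAΩ hy') (e.injOn (hx (mem_image_of_mem ψ hy)) (hx (mem_image_of_mem ψ hy')) h)
  have hTd : ∀ y ∈ A, HasFDerivAt T (fderiv ℝ T y) y := by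
    intro y hy
    have h1 : MDifferentiableAt (𝓡 m) (𝓡 m) ψ y :=
      (hψ.contMDiffAt (hΩ.mem_nhds (hAΩ hy))).mdifferentiableAt one_ne_zero
    have h2 : MDifferentiableAt (𝓡 m) (𝓡 m) e (ψ y) :=
      mdifferentiableAt_extChartAt (by simpa [e] using hx (mem_image_of_mem ψ hy))
    exact (h2.comp y h1).differentiableAt.hasFDerivAt
  rw [chartMeasure_apply hmeas, hset, lintegral_image_eq_lintegral_abs_det_fderiv_mul volume hA
    (fun y hy => (hTd y hy).hasFDerivWithinAt) hinjT]
  refine setLIntegral_congr_fun hA fun y hy => ?_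
  have hsy := hx (mem_image_of_mem ψ hy)
  have h3 : MDifferentiableAt (𝓡 m) (𝓡 m) e.symm (T y) := by
    have := mdifferentiableWithinAt_extChartAt_symm (I := 𝓡 m) (x := x) (e.map_source hsy)
    rwa [ModelWithCorners.range_eq_univ, mdifferentiableWithinAt_univ] at this
  have hev : ψ =ᶠ[𝓝 y] e.symm ∘ T := by
    have hc : ContinuousAt ψ y := (hψ.continuousOn.continuousAt (hΩ.mem_nhds (hAΩ hy)))
    filter_upwards [hc.preimage_mem_nhds ((isOpen_extChartAt_source x).mem_nhds hsy)] with z hz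
    exact (e.left_inv hz).symm
  rw [gramMatrix_congr hev, gramMatrix_comp (hTd y hy) h3, Real.sqrt_mul (sq_nonneg _), Real.sqrt_sq_eq_abs,
    ENNReal.ofReal_mul (abs_nonneg _)]

theorem volumeMeasure_eq_iSup :
    volumeMeasure (M := M) m = ⨆ x : M, chartMeasure (m := m) x := rfl

/-- The supremum of measures is controlled through its universal property: each chart measure agrees
with that of `x` on the overlap, so all lie below the chart measure of `x` plus the measure `⊤` on
the complement of the chart domain. The latter does not see `S`. -/
theorem volumeMeasure_eq_chartMeasure {x : M} {S : Set M} (hS : MeasurableSet S)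
    (hSx : S ⊆ (extChartAt (𝓡 m) x).source) :
    volumeMeasure m S = chartMeasure (m := m) x S := by
  refine le_antisymm ?_ (Measure.le_iff.1 (le_iSup (fun x : M => chartMeasure (m := m) x) x) S hS)
  set U := (extChartAt (𝓡 m) x).source
  have hU : MeasurableSet U := (isOpen_extChartAt_source x).measurableSet
  have hle : volumeMeasure (M := M) m ≤
      chartMeasure (m := m) x + (⊤ : Measure M).restrict Uᶜ := by
    rw [volumeMeasure_eq_iSup]
    refine iSup_le fun z => Measure.le_iff.2 fun B hB => ?_
    set V := (extChartAt (𝓡 m) z).source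
    have hV : MeasurableSet V := (isOpen_extChartAt_source z).measurableSet
    rw [← measure_inter_add_sdiff B hU, Measure.add_apply, Measure.restrict_apply hB]
    refine add_le_add ?_ (Measure.le_iff.1 le_top _ (hB.diff hU))
    rw [chartMeasure_inter_source (hB.inter hU)]
    set B' := B ∩ U ∩ V
    have hB' : MeasurableSet B' := (hB.inter hU).inter hV
    set A := (extChartAt (𝓡 m) x).symm ⁻¹' B' ∩ (extChartAt (𝓡 m) x).target
    have hA : MeasurableSet A := by
      exact measurableSet_preimage_inter_of_continuousOn (continuousOn_extChartAt_symm x)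
        (isOpen_extChartAt_target x).measurableSet hB'
    have hAt : A ⊆ (extChartAt (𝓡 m) x).target := inter_subset_right
    have himg : (extChartAt (𝓡 m) x).symm '' A = B' := by
      ext p
      constructor
      · rintro ⟨y, hy, rfl⟩; exact hy.1
      · intro hp
        have hpU : p ∈ U := hp.1.2
        refine ⟨extChartAt (𝓡 m) x p, ⟨?_, (extChartAt (𝓡 m) x).map_source hpU⟩,
          (extChartAt (𝓡 m) x).left_inv hpU⟩
        rw [mem_preimage, (extChartAt (𝓡 m) x).left_inv hpU]; exact hp
    have key : ∀ w : M, B' ⊆ (extChartAt (𝓡 m) w).source →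
        chartMeasure (m := m) w B' = ∫⁻ y in A,
          ENNReal.ofReal √(gramMatrix (extChartAt (𝓡 m) x).symm y).det := by
      intro w hw
      rw [← himg] at hw ⊢
      exact chartMeasure_image (isOpen_extChartAt_target x) (contMDiffOn_extChartAt_symm x)
        (extChartAt (𝓡 m) x).symm.injOn hA hAt hw
    rw [key z inter_subset_right, ← key x (inter_subset_left.trans inter_subset_right)]
    exact measure_mono (inter_subset_left.trans inter_subset_left)
  calc volumeMeasure m S
      ≤ (chartMeasure (m := m) x + (⊤ : Measure M).restrict Uᶜ) S := Measure.le_iff.1 hle S hS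
    _ = chartMeasure (m := m) x S := by
      rw [Measure.add_apply, Measure.restrict_apply hS, ← Set.sdiff_eq, sdiff_eq_empty.2 hSx]
      simp

variable [SecondCountableTopology M]

/-- In a parametrization `ψ`, the Riemannian volume is `√(det g_ij) dy`. -/
theorem volumeMeasure_restrict_image {ψ : EuclideanSpace ℝ (Fin m) → M}
    {Ω : Set (EuclideanSpace ℝ (Fin m))}
    (hΩ : IsOpen Ω) (hψ : ContMDiffOn (𝓡 m) (𝓡 m) 1 ψ Ω) (hinj : InjOn ψ Ω) :
    (volumeMeasure m).restrict (ψ '' Ω) = Measure.map ψ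
      ((volume.withDensity fun y => ENNReal.ofReal √(gramMatrix ψ y).det).restrict Ω) := by
  obtain ⟨s, hs, hcov⟩ := TopologicalSpace.countable_cover_nhds
    (fun x : M => extChartAt_source_mem_nhds (I := 𝓡 m) x)
  have hψm : ∀ μ : Measure (EuclideanSpace ℝ (Fin m)), AEMeasurable ψ (μ.restrict Ω) :=
    fun μ => hψ.continuousOn.aemeasurable hΩ.measurableSet
  have hΩi : MeasurableSet (ψ '' Ω) :=
    hΩ.measurableSet.image_of_continuousOn_injOn hψ.continuousOn hinj
  have := hs.to_subtype
  refine Measure.ext_of_iUnion_eq_univ (s := fun x : s => (extChartAt (𝓡 m) (x : M)).source)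
    (by rw [iUnion_coe_set]; exact hcov) fun x => ?_
  ext B hB
  have hU : MeasurableSet (extChartAt (𝓡 m) (x : M)).source :=
    (isOpen_extChartAt_source (x : M)).measurableSet
  set B' := B ∩ (extChartAt (𝓡 m) (x : M)).source
  have hB' : MeasurableSet B' := hB.inter hU
  set A := ψ ⁻¹' B' ∩ Ω
  have hA : MeasurableSet A :=
    measurableSet_preimage_inter_of_continuousOn hψ.continuousOn hΩ.measurableSet hB'
  have himg : ψ '' A = B' ∩ ψ '' Ω := by
    rw [image_preimage_inter]
  rw [Measure.restrict_apply hB, Measure.restrict_apply hB, Measure.restrict_apply hB',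
    ← himg, volumeMeasure_eq_chartMeasure (x := (x : M)) (by rw [himg]; exact hB'.inter hΩi)
      (by rw [himg]; exact inter_subset_left.trans inter_subset_right),
    chartMeasure_image hΩ hψ hinj hA inter_subset_right
      (by rw [himg]; exact inter_subset_left.trans inter_subset_right),
    Measure.map_apply_of_aemeasurable (hψm _) hB',
    Measure.restrict_apply₀' hΩ.measurableSet.nullMeasurableSet, withDensity_apply']

end Volume

/-! ### Distortion of charts near their centre -/

section ChartBounds

variable {E : Type*} [NormedAddCommGroup E] [NormedSpace ℝ E]
  {H : Type*} [TopologicalSpace H] {I : ModelWithCorners ℝ E H} [I.Boundaryless]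
  {N : Type*} [TopologicalSpace N] [ChartedSpace H N] [IsManifold I 1 N]

theorem mfderiv_extChartAt_comp_symm {x : N} {y : E} (hy : y ∈ (extChartAt I x).target) (v : E) :
    (mfderiv I 𝓘(ℝ, E) (extChartAt I x) ((extChartAt I x).symm y)
      (mfderiv 𝓘(ℝ, E) I (extChartAt I x).symm y v) : E) = v := by
  have h := mfderiv_extChartAt_comp_mfderivWithin_extChartAt_symm (I := I) hy
  rw [ModelWithCorners.range_eq_univ, mfderivWithin_univ] at h
  exact congrArg (fun D : E →L[ℝ] E => D v) h

variable [RiemannianBundle (fun p : N => TangentSpace I p)]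
  [IsContinuousRiemannianBundle E (fun p : N => TangentSpace I p)]

attribute [local instance] normedAddCommGroupTangentSpaceVectorSpace
attribute [local instance] normedSpaceTangentSpaceVectorSpace

/-- The upper bound is local boundedness of the derivative of the inverse chart. The lower bound
comes from the same fact for the chart, as the two derivatives are inverse to each other. -/
theorem exists_bounds_mfderiv_extChartAt_symm (x : N) :
    ∃ k K : ℝ, 0 < k ∧ 0 < K ∧ ∀ᶠ y in 𝓝 (extChartAt I x x), ∀ v : E,
      k * ‖v‖ ≤ ‖mfderiv 𝓘(ℝ, E) I (extChartAt I x).symm y v‖ ∧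
        ‖mfderiv 𝓘(ℝ, E) I (extChartAt I x).symm y v‖ ≤ K * ‖v‖ := by
  obtain ⟨K, hK, hup⟩ := eventually_norm_mfderivWithin_symm_extChartAt_lt I x
  obtain ⟨C, hC, hlow⟩ := eventually_norm_mfderiv_extChartAt_lt I x
  rw [ModelWithCorners.range_eq_univ, nhdsWithin_univ] at hup
  have hcont : Tendsto (extChartAt I x).symm (𝓝 (extChartAt I x x)) (𝓝 x) := by
    have h := (continuousAt_extChartAt_symm (I := I) x).tendsto
    rwa [extChartAt_to_inv] at h
  have hlow' := hcont.eventually hlow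
  refine ⟨C⁻¹, K, inv_pos.2 hC, hK, ?_⟩
  filter_upwards [hup, hlow', extChartAt_target_mem_nhds x] with y h1 h2 hy v
  rw [mfderivWithin_univ] at h1
  constructor
  · rw [inv_mul_le_iff₀ hC]
    have := (ContinuousLinearMap.le_of_opNorm_le _ h2.le
      (mfderiv 𝓘(ℝ, E) I (extChartAt I x).symm y v))
    have h3 := mfderiv_extChartAt_comp_symm (I := I) hy v
    calc ‖v‖ = _ := congrArg (fun w : E => ‖w‖) h3.symm
      _ ≤ _ := this
  · exact ContinuousLinearMap.le_of_opNorm_le _ h1.le v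

end ChartBounds

/-! ### Parametrizations of bounded distortion -/

section Param

variable {m : ℕ} {M : Type*} [TopologicalSpace M]
  [ChartedSpace (EuclideanSpace ℝ (Fin m)) M]
  [RiemannianBundle (fun p : M => TangentSpace (𝓡 m) p)]

/-- An injective `C^1` parametrization `ψ : Ω → M` of a subset of a Riemannian manifold that distorts
the norms of tangent vectors by a bounded factor. -/
structure IsBilipParam (ψ : EuclideanSpace ℝ (Fin m) → M) (Ω : Set (EuclideanSpace ℝ (Fin m)))
    (k K : ℝ) : Prop where
  isOpen : IsOpen Ω
  contMDiffOn : ContMDiffOn (𝓡 m) (𝓡 m) 1 ψ Ω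
  injOn : InjOn ψ Ω
  k_pos : 0 < k
  K_pos : 0 < K
  low : ∀ y ∈ Ω, ∀ v : EuclideanSpace ℝ (Fin m), k * ‖v‖ ≤ ‖mfderiv (𝓡 m) (𝓡 m) ψ y v‖
  up : ∀ y ∈ Ω, ∀ v : EuclideanSpace ℝ (Fin m), ‖mfderiv (𝓡 m) (𝓡 m) ψ y v‖ ≤ K * ‖v‖

theorem IsBilipParam.mono {ψ : EuclideanSpace ℝ (Fin m) → M} {Ω Ω' : Set (EuclideanSpace ℝ (Fin m))}
    {k K : ℝ} (h : IsBilipParam ψ Ω k K) (hΩ' : IsOpen Ω') (hsub : Ω' ⊆ Ω) :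
    IsBilipParam ψ Ω' k K :=
  ⟨hΩ', h.contMDiffOn.mono hsub, h.injOn.mono hsub, h.k_pos, h.K_pos,
    fun y hy => h.low y (hsub hy), fun y hy => h.up y (hsub hy)⟩

theorem IsBilipParam.det_bounds {ψ : EuclideanSpace ℝ (Fin m) → M}
    {Ω : Set (EuclideanSpace ℝ (Fin m))} {k K : ℝ} (h : IsBilipParam ψ Ω k K)
    {y : EuclideanSpace ℝ (Fin m)} (hy : y ∈ Ω) :
    k ^ m ≤ √(gramMatrix ψ y).det ∧ √(gramMatrix ψ y).det ≤ K ^ m := by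
  have hk := h.k_pos
  have hK := h.K_pos
  have := det_gramMatrix_bounds (ψ := ψ) (y := y) (k := k ^ 2) (K := K ^ 2) (sq_nonneg k)
    (fun v => by rw [← mul_pow]; exact pow_le_pow_left₀ (by positivity) (h.low y hy v) 2)
    (fun v => by rw [← mul_pow]; exact pow_le_pow_left₀ (norm_nonneg _) (h.up y hy v) 2)
  rw [← pow_mul, ← pow_mul, mul_comm, pow_mul, pow_mul] at this
  constructor
  · exact Real.le_sqrt_of_sq_le this.1
  · rw [Real.sqrt_le_left (by positivity)]; exact this.2

theorem exists_isBilipParam [IsManifold (𝓡 m) 1 M]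
    [IsContinuousRiemannianBundle (EuclideanSpace ℝ (Fin m)) (fun p : M => TangentSpace (𝓡 m) p)]
    (x : M) : ∃ k K r : ℝ, 0 < r ∧
    Metric.ball (extChartAt (𝓡 m) x x) r ⊆ (extChartAt (𝓡 m) x).target ∧
    IsBilipParam (extChartAt (𝓡 m) x).symm (Metric.ball (extChartAt (𝓡 m) x x) r) k K := by
  obtain ⟨k, K, hk, hK, hev⟩ := exists_bounds_mfderiv_extChartAt_symm (I := 𝓡 m) x
  obtain ⟨r, hr, hsub⟩ := Metric.mem_nhds_iff.1
    (inter_mem hev (extChartAt_target_mem_nhds (I := 𝓡 m) x))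
  have ht : Metric.ball (extChartAt (𝓡 m) x x) r ⊆ (extChartAt (𝓡 m) x).target :=
    fun y hy => (hsub hy).2
  exact ⟨k, K, r, hr, ht, Metric.isOpen_ball, (contMDiffOn_extChartAt_symm x).mono ht,
    (extChartAt (𝓡 m) x).symm.injOn.mono ht, hk, hK, fun y hy v => ((hsub hy).1 v).1,
    fun y hy v => ((hsub hy).1 v).2⟩

variable [T2Space M] [SecondCountableTopology M] [MeasurableSpace M] [BorelSpace M]
  [IsManifold (𝓡 m) 1 M]
  [IsContinuousRiemannianBundle (EuclideanSpace ℝ (Fin m)) (fun p : M => TangentSpace (𝓡 m) p)]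

theorem IsBilipParam.measurableSet_image {ψ : EuclideanSpace ℝ (Fin m) → M}
    {Ω : Set (EuclideanSpace ℝ (Fin m))} {k K : ℝ} (h : IsBilipParam ψ Ω k K) :
    MeasurableSet (ψ '' Ω) :=
  h.isOpen.measurableSet.image_of_continuousOn_injOn h.contMDiffOn.continuousOn h.injOn

theorem IsBilipParam.aemeasurable {ψ : EuclideanSpace ℝ (Fin m) → M}
    {Ω : Set (EuclideanSpace ℝ (Fin m))} {k K : ℝ} (h : IsBilipParam ψ Ω k K)
    (μ : Measure (EuclideanSpace ℝ (Fin m))) : AEMeasurable ψ (μ.restrict Ω) :=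
  h.contMDiffOn.continuousOn.aemeasurable h.isOpen.measurableSet

theorem IsBilipParam.setLIntegral_image {ψ : EuclideanSpace ℝ (Fin m) → M}
    {Ω : Set (EuclideanSpace ℝ (Fin m))} {k K : ℝ} (h : IsBilipParam ψ Ω k K) {F : M → ENNReal}
    (hF : Measurable F) :
    ∫⁻ p in ψ '' Ω, F p ∂(volumeMeasure m) =
      ∫⁻ y in Ω, ENNReal.ofReal √(gramMatrix ψ y).det * F (ψ y) := by
  have hd : AEMeasurable (fun y => ENNReal.ofReal √(gramMatrix ψ y).det)
      ((volume : Measure (EuclideanSpace ℝ (Fin m))).restrict Ω) := by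
    refine AEMeasurable.ennreal_ofReal (ContinuousOn.aemeasurable ?_ h.isOpen.measurableSet)
    have := continuousOn_gramMatrix h.isOpen h.contMDiffOn
    exact Real.continuous_sqrt.comp_continuousOn
      ((continuous_id.matrix_det).comp_continuousOn this)
  rw [volumeMeasure_restrict_image h.isOpen h.contMDiffOn h.injOn,
    lintegral_map' hF.aemeasurable (h.aemeasurable _),
    restrict_withDensity h.isOpen.measurableSet]
  exact lintegral_withDensity_eq_lintegral_mul₀ hd (hF.comp_aemeasurable (h.aemeasurable _))

/-- The volume density lies between `k ^ m` and `K ^ m`. Up to these constants, integrals over `M`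
become Lebesgue integrals, for which translations preserve the measure. The next lemma is the
opposite bound. -/
theorem IsBilipParam.setLIntegral_image_le {ψ : EuclideanSpace ℝ (Fin m) → M}
    {Ω : Set (EuclideanSpace ℝ (Fin m))} {k K : ℝ} (h : IsBilipParam ψ Ω k K) {F : M → ENNReal}
    (hF : Measurable F) :
    ∫⁻ p in ψ '' Ω, F p ∂(volumeMeasure m) ≤ ENNReal.ofReal (K ^ m) * ∫⁻ y in Ω, F (ψ y) := by
  rw [h.setLIntegral_image hF, ← lintegral_const_mul' _ _ ENNReal.ofReal_ne_top]
  refine setLIntegral_mono' h.isOpen.measurableSet fun y hy => ?_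
  gcongr
  exact (h.det_bounds hy).2

theorem IsBilipParam.le_setLIntegral_image {ψ : EuclideanSpace ℝ (Fin m) → M}
    {Ω : Set (EuclideanSpace ℝ (Fin m))} {k K : ℝ} (h : IsBilipParam ψ Ω k K) {F : M → ENNReal}
    (hF : Measurable F) :
    ∫⁻ y in Ω, F (ψ y) ≤ ENNReal.ofReal ((k ^ m)⁻¹) * ∫⁻ p in ψ '' Ω, F p ∂(volumeMeasure m) := by
  have hk : 0 < k ^ m := pow_pos h.k_pos m
  rw [h.setLIntegral_image hF, ← lintegral_const_mul' _ _ ENNReal.ofReal_ne_top]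
  refine setLIntegral_mono' h.isOpen.measurableSet fun y hy => ?_
  rw [← mul_assoc, ← ENNReal.ofReal_mul (by positivity)]
  refine le_mul_of_one_le_left zero_le ?_
  rw [← ENNReal.ofReal_one]
  refine ENNReal.ofReal_le_ofReal ?_
  rw [inv_mul_eq_div, one_le_div hk]
  exact (h.det_bounds hy).1

/-- Each point has a neighbourhood that is the image of a Euclidean ball under a parametrization of
bounded density. -/
theorem isFiniteMeasureOnCompacts_volumeMeasure :
    IsFiniteMeasureOnCompacts (volumeMeasure (M := M) m) := by
  have : IsLocallyFiniteMeasure (volumeMeasure (M := M) m) := by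
    refine ⟨fun x => ?_⟩
    obtain ⟨k, K, r, hr, ht, h⟩ := exists_isBilipParam (m := m) x
    refine ⟨(extChartAt (𝓡 m) x).symm '' Metric.ball (extChartAt (𝓡 m) x x) r, ?_, ?_⟩
    · rw [(extChartAt (𝓡 m) x).symm_image_eq_source_inter_preimage ht]
      exact inter_mem (extChartAt_source_mem_nhds x)
        ((continuousAt_extChartAt x).preimage_mem_nhds (Metric.ball_mem_nhds _ hr))
    · have := h.setLIntegral_image_le (F := fun _ => 1) measurable_const
      simp only [lintegral_const, one_mul, Measure.restrict_apply MeasurableSet.univ,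
        univ_inter] at this
      exact this.trans_lt (ENNReal.mul_lt_top ENNReal.ofReal_lt_top measure_ball_lt_top)
  infer_instance

end Param

/-! ### The gradient in coordinates -/

section Gradient

variable {m : ℕ} {M : Type*} [TopologicalSpace M]
  [ChartedSpace (EuclideanSpace ℝ (Fin m)) M]
  [RiemannianBundle (fun p : M => TangentSpace (𝓡 m) p)]

theorem inner_riemGradient (u : M → ℝ) (p : M) (v : TangentSpace (𝓡 m) p) :
    inner ℝ (riemGradient m u p) v = mvfderiv (𝓡 m) u p v := by
  have : FiniteDimensional ℝ (TangentSpace (𝓡 m) p) :=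
    inferInstanceAs (FiniteDimensional ℝ (EuclideanSpace ℝ (Fin m)))
  have : CompleteSpace (TangentSpace (𝓡 m) p) := FiniteDimensional.complete ℝ _
  exact InnerProductSpace.toDual_symm_apply

theorem fderiv_comp_eq_inner_riemGradient {u : M → ℝ} {ψ : EuclideanSpace ℝ (Fin m) → M}
    {y : EuclideanSpace ℝ (Fin m)} (hu : MDifferentiableAt (𝓡 m) 𝓘(ℝ, ℝ) u (ψ y))
    (hψ : MDifferentiableAt (𝓡 m) (𝓡 m) ψ y) (v : EuclideanSpace ℝ (Fin m)) :
    fderiv ℝ (fun z => u (ψ z)) y v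
      = inner ℝ (riemGradient m u (ψ y)) (mfderiv (𝓡 m) (𝓡 m) ψ y v) := by
  rw [inner_riemGradient]
  have h := mfderiv_comp y hu hψ
  rw [mfderiv_eq_fderiv] at h
  exact congrArg (fun D : EuclideanSpace ℝ (Fin m) →L[ℝ] ℝ => D v) h

theorem IsBilipParam.sq_fderiv_comp_le {ψ : EuclideanSpace ℝ (Fin m) → M}
    {Ω : Set (EuclideanSpace ℝ (Fin m))} {k K : ℝ} (h : IsBilipParam ψ Ω k K) {u : M → ℝ}
    (hu : ContMDiff (𝓡 m) 𝓘(ℝ, ℝ) 1 u) {y : EuclideanSpace ℝ (Fin m)} (hy : y ∈ Ω)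
    (v : EuclideanSpace ℝ (Fin m)) :
    fderiv ℝ (fun z => u (ψ z)) y v ^ 2 ≤ (K * ‖v‖) ^ 2 * ‖riemGradient m u (ψ y)‖ ^ 2 := by
  have hψ : MDifferentiableAt (𝓡 m) (𝓡 m) ψ y :=
    (h.contMDiffOn.contMDiffAt (h.isOpen.mem_nhds hy)).mdifferentiableAt one_ne_zero
  rw [fderiv_comp_eq_inner_riemGradient (hu.mdifferentiable one_ne_zero _) hψ, ← sq_abs, ← mul_pow]
  refine pow_le_pow_left₀ (abs_nonneg _) ((abs_real_inner_le_norm _ _).trans ?_) 2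
  rw [mul_comm]
  gcongr
  exact h.up y hy v

theorem IsBilipParam.contDiffOn_comp {ψ : EuclideanSpace ℝ (Fin m) → M}
    {Ω : Set (EuclideanSpace ℝ (Fin m))} {k K : ℝ} (h : IsBilipParam ψ Ω k K) {u : M → ℝ}
    (hu : ContMDiff (𝓡 m) 𝓘(ℝ, ℝ) 1 u) : ContDiffOn ℝ 1 (fun y => u (ψ y)) Ω :=
  contMDiffOn_iff_contDiffOn.1 (hu.comp_contMDiffOn h.contMDiffOn)

variable [T2Space M] [IsManifold (𝓡 m) 1 M]
  [IsContinuousRiemannianBundle (EuclideanSpace ℝ (Fin m)) (fun p : M => TangentSpace (𝓡 m) p)]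

/-- In a chart `|∇u|² = g^{ij} ∂_i u ∂_j u`, and every factor is continuous. This provides
measurability and finiteness of the energy integrals. -/
theorem continuous_norm_sq_riemGradient {u : M → ℝ} (hu : ContMDiff (𝓡 m) 𝓘(ℝ, ℝ) 1 u) :
    Continuous fun p => ‖riemGradient m u p‖ ^ 2 := by
  rw [continuous_iff_continuousAt]
  intro x
  obtain ⟨k, K, r, hr, ht, h⟩ := exists_isBilipParam (m := m) x
  set e := extChartAt (𝓡 m) x
  set Ω := Metric.ball (e x) r
  set a : EuclideanSpace ℝ (Fin m) → Fin m → ℝ :=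
    fun y i => fderiv ℝ (fun z => u (e.symm z)) y (stdBasis m i) with ha
  have hdet : ∀ y ∈ Ω, (gramMatrix e.symm y).det ≠ 0 := by
    intro y hy h0
    have := (h.det_bounds hy).1
    rw [h0, Real.sqrt_zero] at this
    exact absurd this (not_le.2 (pow_pos h.k_pos m))
  have hformula : ∀ y ∈ Ω, ‖riemGradient m u (e.symm y)‖ ^ 2
      = a y ⬝ᵥ (gramMatrix e.symm y)⁻¹.mulVec (a y) := by
    intro y hy
    have hψ : MDifferentiableAt (𝓡 m) (𝓡 m) e.symm y :=
      (h.contMDiffOn.contMDiffAt (h.isOpen.mem_nhds hy)).mdifferentiableAt one_ne_zero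
    have hu' := hu.mdifferentiable one_ne_zero (e.symm y)
    have hin := fderiv_comp_eq_inner_riemGradient hu' hψ
    -- `ξ` holds the coefficients of the gradient in the coordinate vectors. They solve the linear
    -- system whose matrix is the Gram matrix and whose right-hand side is `a y`.
    obtain ⟨ξ, hξ⟩ : ∃ ξ : EuclideanSpace ℝ (Fin m),
        mfderiv (𝓡 m) (𝓡 m) e.symm y ξ = riemGradient m u (e.symm y) := by
      let D : EuclideanSpace ℝ (Fin m) →L[ℝ] EuclideanSpace ℝ (Fin m) :=
        mfderiv (𝓡 m) (𝓡 m) e.symm y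
      have hinj : Function.Injective D.toLinearMap := by
        refine Function.LeftInverse.injective (g := fun w => mfderiv (𝓡 m) (𝓡 m) e (e.symm y) w) ?_
        exact fun v => mfderiv_extChartAt_comp_symm (I := 𝓡 m) (ht hy) v
      exact LinearMap.surjective_of_injective hinj _
    have hPξ : (gramMatrix e.symm y).mulVec ξ.ofLp = a y := by
      ext i
      have h1 := dotProduct_gramMatrix_mulVec e.symm y (stdBasis m i) ξ
      rw [hξ, real_inner_comm, ← hin] at h1
      simpa [ha] using h1
    have hξa : ξ.ofLp = (gramMatrix e.symm y)⁻¹.mulVec (a y) := by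
      rw [← hPξ, Matrix.mulVec_mulVec, Matrix.nonsing_inv_mul _ (hdet y hy).isUnit,
        Matrix.one_mulVec]
    rw [← hξa, ← hPξ, dotProduct_comm, dotProduct_gramMatrix_mulVec, hξ, real_inner_self_eq_norm_sq]
  have hcontΩ : ContinuousOn (fun y => ‖riemGradient m u (e.symm y)‖ ^ 2) Ω := by
    refine ContinuousOn.congr ?_ hformula
    have hac : ContinuousOn a Ω := continuousOn_pi.2 fun i =>
      ((h.contDiffOn_comp hu).continuousOn_fderiv_of_isOpen h.isOpen le_rfl).clm_apply
        continuousOn_const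
    have hG := continuousOn_gramMatrix h.isOpen h.contMDiffOn
    have hinv : ContinuousOn (fun y => (gramMatrix e.symm y)⁻¹) Ω := by
      simp only [Matrix.inv_def, Ring.inverse_eq_inv']
      refine ContinuousOn.smul (ContinuousOn.inv₀ ?_ hdet) ?_
      · exact (continuous_id.matrix_det).comp_continuousOn hG
      · exact (continuous_id.matrix_adjugate).comp_continuousOn hG
    exact (Continuous.dotProduct continuous_snd (continuous_fst.matrix_mulVec
      continuous_snd)).comp_continuousOn (hinv.prodMk hac)
  have hx : e x ∈ Ω := Metric.mem_ball_self hr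
  have h1 : ContinuousAt (fun p => ‖riemGradient m u (e.symm (e p))‖ ^ 2) x :=
    ContinuousAt.comp (f := e) (g := fun y => ‖riemGradient m u (e.symm y)‖ ^ 2)
      (hcontΩ.continuousAt (h.isOpen.mem_nhds hx)) (continuousAt_extChartAt x)
  refine h1.congr ?_
  filter_upwards [extChartAt_source_mem_nhds (I := 𝓡 m) x] with p hp
  rw [e.left_inv hp]

end Gradient

/-! ### The norm of a 2-tensor as a bound on its quadratic form -/

section TensorNorm

variable {ι : Type*} [Fintype ι] [DecidableEq ι]

open scoped MatrixOrder in
theorem exists_transpose_mul_self {A : Matrix ι ι ℝ} (hA : A.PosSemidef) :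
    ∃ B : Matrix ι ι ℝ, A = B.transpose * B := by
  obtain ⟨B, hB⟩ := CStarAlgebra.nonneg_iff_eq_star_mul_self.mp hA.nonneg
  exact ⟨B, by simpa [Matrix.star_eq_conjTranspose] using hB⟩

/-- A factorization of the inverse metric amounts to an orthonormal frame, in which the tensor norm
is the Frobenius norm of the components. -/
theorem tensorNorm_two_eq {A S B : Matrix ι ι ℝ} (hB : A⁻¹ = B.transpose * B) :
    tensorNorm A (fun K : Fin 2 → ι => S (K 0) (K 1))
      = √(∑ a, ∑ b, (B * S * B.transpose) a b ^ 2) := by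
  have htr : ∀ X : Matrix ι ι ℝ, ∑ a, ∑ b, X a b ^ 2 = (X.transpose * X).trace := by
    intro X
    rw [Finset.sum_comm]
    simp [Matrix.trace, Matrix.mul_apply, pow_two]
  have hsymm : (A⁻¹).transpose = A⁻¹ := by rw [hB]; simp
  have hpair : ∀ F : (Fin 2 → ι) → ℝ, ∑ K, F K = ∑ i, ∑ j, F ![i, j] := by
    intro F
    rw [← (finTwoArrowEquiv ι).symm.sum_comp F, Fintype.sum_prod_type]
    rfl
  have hlhs : ∑ I : Fin 2 → ι, ∑ J : Fin 2 → ι, (∏ l, A⁻¹ (I l) (J l)) * S (I 0) (I 1) * S (J 0) (J 1)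
      = (S.transpose * (A⁻¹ * S * A⁻¹)).trace := by
    rw [hpair]
    simp only [hpair (fun J : Fin 2 → ι => _ * _ * S (J 0) (J 1)), Fin.prod_univ_two,
      Matrix.cons_val_zero, Matrix.cons_val_one, Matrix.trace, Matrix.diag, Matrix.mul_apply,
      Matrix.transpose_apply, Finset.mul_sum, Finset.sum_mul]
    rw [Finset.sum_comm]
    refine Finset.sum_congr rfl fun j _ => Finset.sum_congr rfl fun i _ => ?_
    rw [Finset.sum_comm]
    refine Finset.sum_congr rfl fun l _ => Finset.sum_congr rfl fun k _ => ?_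
    have : A⁻¹ l j = A⁻¹ j l := congrFun (congrFun hsymm j) l
    rw [this]; ring
  unfold tensorNorm
  rw [hlhs, htr, hB]
  congr 1
  simp only [Matrix.transpose_mul, Matrix.transpose_transpose, Matrix.mul_assoc]
  conv_rhs => rw [Matrix.trace_mul_comm]
  simp only [Matrix.mul_assoc]

/-- The norm of a 2-tensor bounds its quadratic form. -/
theorem abs_quadratic_le_tensorNorm {A S : Matrix ι ι ℝ} (hA : A.PosDef) (v : ι → ℝ) :
    |v ⬝ᵥ S.mulVec v| ≤
      tensorNorm A (fun K : Fin 2 → ι => S (K 0) (K 1)) * (v ⬝ᵥ A.mulVec v) := by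
  obtain ⟨B, hB⟩ := exists_transpose_mul_self hA.inv.posSemidef
  rw [tensorNorm_two_eq hB]
  set X := B * S * B.transpose
  -- The components of `v` in the orthonormal frame. The claim becomes `|wᵀ X w| ≤ ‖X‖ ‖w‖²` with
  -- the Frobenius norm, which is Cauchy–Schwarz over pairs of indices.
  set w := B.mulVec (A.mulVec v) with hw
  have hunit : IsUnit A.det := (Matrix.isUnit_iff_isUnit_det A).1 hA.isUnit
  have hBw : B.transpose.mulVec w = v := by
    rw [hw, Matrix.mulVec_mulVec, ← hB, Matrix.mulVec_mulVec, Matrix.nonsing_inv_mul _ hunit,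
      Matrix.one_mulVec]
  have h1 : w ⬝ᵥ X.mulVec w = v ⬝ᵥ S.mulVec v := by
    rw [← hBw]
    simp only [X, ← Matrix.mulVec_mulVec]
    rw [Matrix.dotProduct_mulVec w B, ← Matrix.mulVec_transpose]
  have h2 : w ⬝ᵥ w = v ⬝ᵥ A.mulVec v := by
    conv_lhs => rw [hw]
    rw [dotProduct_comm, Matrix.dotProduct_mulVec, ← Matrix.mulVec_transpose, hBw]
  have hnn : 0 ≤ w ⬝ᵥ w := by
    simp only [dotProduct]; exact Finset.sum_nonneg fun i _ => mul_self_nonneg _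
  rw [← h1, ← h2]
  refine abs_le_of_sq_le_sq ?_ (by positivity)
  rw [mul_pow, Real.sq_sqrt (by positivity)]
  have hexp : w ⬝ᵥ X.mulVec w = ∑ z : ι × ι, X z.1 z.2 * (w z.1 * w z.2) := by
    rw [Fintype.sum_prod_type]
    simp only [dotProduct, Matrix.mulVec, Finset.mul_sum]
    exact Finset.sum_congr rfl fun i _ => Finset.sum_congr rfl fun j _ => by ring
  have hX : ∑ a, ∑ b, X a b ^ 2 = ∑ z : ι × ι, X z.1 z.2 ^ 2 := by rw [Fintype.sum_prod_type]
  have hww : (w ⬝ᵥ w) ^ 2 = ∑ z : ι × ι, (w z.1 * w z.2) ^ 2 := by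
    rw [Fintype.sum_prod_type, pow_two]
    simp only [dotProduct, Finset.sum_mul_sum]
    exact Finset.sum_congr rfl fun i _ => Finset.sum_congr rfl fun j _ => by ring
  rw [hexp, hX, hww]
  exact Finset.sum_mul_sq_le_sq_mul_sq _ _ _

end TensorNorm

/-! ### Coordinate components as a bilinear form -/

section CovNorm

variable {ι : Type*} [Fintype ι] [DecidableEq ι]
  {E : Type*} [NormedAddCommGroup E] [NormedSpace ℝ E] [FiniteDimensional ℝ E]
  {H : Type*} [TopologicalSpace H] {I : ModelWithCorners ℝ E H} [I.Boundaryless]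
  {N : Type*} [TopologicalSpace N] [ChartedSpace H N] [IsManifold I 1 N]

/-- At the centre of the chart, the components of a bilinear form represent it in a basis. -/
theorem exists_coord_coordMatrix (b : Module.Basis ι ℝ E) (x : N) :
    ∃ D : (ι → ℝ) ≃ₗ[ℝ] E, ∀ h : ∀ p : N, TangentSpace I p → TangentSpace I p → ℝ,
      ∀ B : E →ₗ[ℝ] E →ₗ[ℝ] ℝ, (∀ v w : E, h x v w = B v w) → ∀ v w : ι → ℝ,
        v ⬝ᵥ (coordMatrix I b h x (extChartAt I x x)).mulVec w = B (D v) (D w) := by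
  set y := extChartAt I x x
  have hy : y ∈ (extChartAt I x).target := mem_extChartAt_target x
  let D : E →L[ℝ] E := mfderiv 𝓘(ℝ, E) I (extChartAt I x).symm y
  have hinj : Function.Injective D.toLinearMap := by
    refine Function.LeftInverse.injective
      (g := fun w => mfderiv I 𝓘(ℝ, E) (extChartAt I x) ((extChartAt I x).symm y) w) ?_
    exact fun v => mfderiv_extChartAt_comp_symm (I := I) hy v
  refine ⟨b.equivFun.symm.trans (LinearEquiv.ofInjectiveEndo D.toLinearMap hinj),
    fun h B hB v w => ?_⟩
  have hpt : (extChartAt I x).symm y = x := extChartAt_to_inv x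
  have haux : ∀ p : N, p = x → ∀ v w : E, h p v w = B v w := by
    rintro _ rfl v w; exact hB v w
  have hmat : ∀ i j, coordMatrix I b h x y i j = B (D (b i)) (D (b j)) := fun i j =>
    haux _ hpt _ _
  have hD : ∀ v : ι → ℝ, (b.equivFun.symm.trans (LinearEquiv.ofInjectiveEndo D.toLinearMap hinj)) v
      = ∑ i, v i • D (b i) := by
    intro v
    simp [Module.Basis.equivFun_symm_apply]
  rw [hD, hD]
  simp only [dotProduct, Matrix.mulVec, hmat, Finset.mul_sum, map_sum, LinearMap.sum_apply,
    map_smul, LinearMap.smul_apply, smul_eq_mul]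
  rw [Finset.sum_comm]
  refine Finset.sum_congr rfl fun j _ => Finset.sum_congr rfl fun i _ => ?_
  ring

end CovNorm

/-! ### The cylindrical metric and the pulled back metric -/

section Cylinder

variable {d : ℕ} {L : Type*} [TopologicalSpace L] [ChartedSpace (EuclideanSpace ℝ (Fin d)) L]
  [IsManifold (𝓡 d) ∞ L]
  (gL : ContMDiffRiemannianMetric (𝓡 d) ∞ (EuclideanSpace ℝ (Fin d))
    (fun x : L => TangentSpace (𝓡 d) x))

theorem cylMetric_apply (q : ℝ × L) (v w : ℝ × EuclideanSpace ℝ (Fin d)) :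
    cylMetric d gL q v w = v.1 * w.1 + gL.inner q.2 v.2 w.2 := by
  simp only [cylMetric, mvfderiv, mfderiv_fst, mfderiv_snd]
  rfl

/-- The cylindrical metric at a point as a bilinear form. -/
def cylBilin (q : ℝ × L) :
    (ℝ × EuclideanSpace ℝ (Fin d)) →ₗ[ℝ] (ℝ × EuclideanSpace ℝ (Fin d)) →ₗ[ℝ] ℝ :=
  let g : EuclideanSpace ℝ (Fin d) →L[ℝ] EuclideanSpace ℝ (Fin d) →L[ℝ] ℝ := gL.inner q.2
  LinearMap.mk₂ ℝ (fun v w => v.1 * w.1 + g v.2 w.2)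
    (fun v v' w => by simp; ring) (fun c v w => by simp; ring)
    (fun v w w' => by simp; ring) (fun c v w => by simp; ring)

theorem cylMetric_self_pos (q : ℝ × L) {v : ℝ × EuclideanSpace ℝ (Fin d)} (hv : v ≠ 0) :
    0 < cylMetric d gL q v v := by
  rw [cylMetric_apply]
  have h1 : 0 ≤ gL.inner q.2 v.2 v.2 := by
    rcases eq_or_ne v.2 0 with h | h
    · have : gL.inner q.2 v.2 v.2 = 0 := by
        rw [h]; exact map_zero (gL.inner q.2 _)
      exact this.ge
    · exact (gL.pos q.2 v.2 h).le
  rcases eq_or_ne v.2 0 with h | h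
  · have h2 : v.1 ≠ 0 := fun h0 => hv (Prod.ext h0 h)
    have := mul_self_pos.2 h2
    linarith
  · have := gL.pos q.2 v.2 h
    have := mul_self_nonneg v.1
    linarith

theorem posDef_coordMatrix_cylMetric (q : ℝ × L) :
    (coordMatrix (cylModel d) (cylBasis d) (cylMetric d gL) q (extChartAt (cylModel d) q q)).PosDef := by
  obtain ⟨D, hD⟩ := exists_coord_coordMatrix (I := cylModel d) (cylBasis d) q
  refine Matrix.PosDef.of_dotProduct_mulVec_pos ?_ fun v hv => ?_
  · ext i j
    simp only [Matrix.conjTranspose_apply, coordMatrix, Matrix.of_apply, star_trivial]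
    rw [cylMetric, cylMetric, mul_comm, gL.symm]
  · have h := hD (cylMetric d gL) (cylBilin gL q) (fun v w => cylMetric_apply gL q v w) v v
    simp only [star_trivial]
    rw [h]
    have h2 := cylMetric_self_pos gL q (v := D v) (by simpa using hv)
    rwa [cylMetric_apply] at h2

variable {M : Type*} [MetricSpace M] [ChartedSpace (EuclideanSpace ℝ (Fin (d + 1))) M]
  [RiemannianBundle (fun p : M => TangentSpace (𝓡 (d + 1)) p)]

/-- The pullback of a Riemannian metric at a point as a bilinear form. -/
def pullbackBilin (Φ : ℝ × L → M) (q : ℝ × L) :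
    (ℝ × EuclideanSpace ℝ (Fin d)) →ₗ[ℝ] (ℝ × EuclideanSpace ℝ (Fin d)) →ₗ[ℝ] ℝ :=
  let D : (ℝ × EuclideanSpace ℝ (Fin d)) →L[ℝ] TangentSpace (𝓡 (d + 1)) (Φ q) :=
    mfderiv (cylModel d) (𝓡 (d + 1)) Φ q
  (innerₗ (TangentSpace (𝓡 (d + 1)) (Φ q))).compl₁₂ D.toLinearMap D.toLinearMap

/-- This turns the decay condition of order zero, stated through components in a chart, into a
comparison of quadratic forms on tangent vectors. -/
theorem abs_sq_norm_mfderiv_sub_cylMetric_le (Φ : ℝ × L → M) (q : ℝ × L)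
    (V : ℝ × EuclideanSpace ℝ (Fin d)) :
    |‖mfderiv (cylModel d) (𝓡 (d + 1)) Φ q V‖ ^ 2 - cylMetric d gL q V V| ≤
      covNorm₂ (cylModel d) (cylBasis d) (cylMetric d gL)
        (fun q v w => pullbackMetric d Φ q v w - cylMetric d gL q v w) 0 q
        * cylMetric d gL q V V := by
  obtain ⟨D, hD⟩ := exists_coord_coordMatrix (I := cylModel d) (cylBasis d) q
  have h1 := hD (cylMetric d gL) (cylBilin gL q) (fun v w => cylMetric_apply gL q v w)
    (D.symm V) (D.symm V)
  have h2 := hD (fun q v w => pullbackMetric d Φ q v w - cylMetric d gL q v w)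
    (pullbackBilin Φ q - cylBilin gL q)
    (fun v w => congrArg₂ (· - ·) rfl (cylMetric_apply gL q v w)) (D.symm V) (D.symm V)
  have h3 := abs_quadratic_le_tensorNorm
    (S := coordMatrix (cylModel d) (cylBasis d)
      (fun q v w => pullbackMetric d Φ q v w - cylMetric d gL q v w) q (extChartAt (cylModel d) q q))
    (posDef_coordMatrix_cylMetric gL q) (D.symm V)
  rw [h1, h2, D.apply_symm_apply] at h3
  have h4 : cylBilin gL q V V = cylMetric d gL q V V := (cylMetric_apply gL q V V).symm
  have h5 : pullbackBilin Φ q V V = ‖mfderiv (cylModel d) (𝓡 (d + 1)) Φ q V‖ ^ 2 :=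
    real_inner_self_eq_norm_sq (mfderiv (cylModel d) (𝓡 (d + 1)) Φ q V)
  rw [LinearMap.sub_apply, LinearMap.sub_apply, h4, h5] at h3
  exact h3

end Cylinder

/-! ### Parametrizations of the cylindrical end -/

section EndParam

variable {d : ℕ} {L : Type*} [TopologicalSpace L] [ChartedSpace (EuclideanSpace ℝ (Fin d)) L]
  [IsManifold (𝓡 d) ∞ L]

theorem exists_bounds_metric_extChartAt_symm
    (gL : ContMDiffRiemannianMetric (𝓡 d) ∞ (EuclideanSpace ℝ (Fin d))
      (fun x : L => TangentSpace (𝓡 d) x)) (x : L) :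
    ∃ k K : ℝ, 0 < k ∧ 0 < K ∧ ∀ᶠ y in 𝓝 (extChartAt (𝓡 d) x x), ∀ v : EuclideanSpace ℝ (Fin d),
      (k * ‖v‖) ^ 2 ≤ gL.inner ((extChartAt (𝓡 d) x).symm y)
        (mfderiv (𝓡 d) (𝓡 d) (extChartAt (𝓡 d) x).symm y v)
        (mfderiv (𝓡 d) (𝓡 d) (extChartAt (𝓡 d) x).symm y v) ∧
      gL.inner ((extChartAt (𝓡 d) x).symm y)
        (mfderiv (𝓡 d) (𝓡 d) (extChartAt (𝓡 d) x).symm y v)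
        (mfderiv (𝓡 d) (𝓡 d) (extChartAt (𝓡 d) x).symm y v) ≤ (K * ‖v‖) ^ 2 := by
  -- The metric of the cross-section is installed as a local instance so that the chart estimate for
  -- Riemannian bundles applies to it.
  let _ : RiemannianBundle (fun x : L => TangentSpace (𝓡 d) x) := ⟨gL.toRiemannianMetric⟩
  have : IsContinuousRiemannianBundle (EuclideanSpace ℝ (Fin d))
      (fun x : L => TangentSpace (𝓡 d) x) :=
    ⟨gL.toContinuousRiemannianMetric.inner, gL.toContinuousRiemannianMetric.continuous,
      fun _ _ _ => rfl⟩
  obtain ⟨k, K, hk, hK, hev⟩ := exists_bounds_mfderiv_extChartAt_symm (I := 𝓡 d) x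
  refine ⟨k, K, hk, hK, ?_⟩
  filter_upwards [hev] with y hy v
  have h : gL.inner ((extChartAt (𝓡 d) x).symm y)
        (mfderiv (𝓡 d) (𝓡 d) (extChartAt (𝓡 d) x).symm y v)
        (mfderiv (𝓡 d) (𝓡 d) (extChartAt (𝓡 d) x).symm y v)
      = ‖mfderiv (𝓡 d) (𝓡 d) (extChartAt (𝓡 d) x).symm y v‖ ^ 2 :=
    real_inner_self_eq_norm_sq (mfderiv (𝓡 d) (𝓡 d) (extChartAt (𝓡 d) x).symm y v)
  rw [h]
  exact ⟨pow_le_pow_left₀ (by positivity) (hy v).1 2, pow_le_pow_left₀ (norm_nonneg _) (hy v).2 2⟩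

/-- Linear coordinates on the model space of the cylinder. -/
def cylCoord (d : ℕ) : EuclideanSpace ℝ (Fin (d + 1)) ≃L[ℝ] ℝ × EuclideanSpace ℝ (Fin d) :=
  ContinuousLinearEquiv.ofFinrankEq (by simp [add_comm])

variable {M : Type*} [MetricSpace M] [ChartedSpace (EuclideanSpace ℝ (Fin (d + 1))) M]
  [RiemannianBundle (fun p : M => TangentSpace (𝓡 (d + 1)) p)]

variable (L) in
/-- The parametrization of the cylinder by `ℝ` times a chart of the cross-section. -/
def cylParam (x : L) (y : EuclideanSpace ℝ (Fin (d + 1))) : ℝ × L :=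
  ((cylCoord d y).1, (extChartAt (𝓡 d) x).symm (cylCoord d y).2)

theorem contMDiffAt_cylParam {x : L} {y : EuclideanSpace ℝ (Fin (d + 1))}
    (hy : (cylCoord d y).2 ∈ (extChartAt (𝓡 d) x).target) :
    ContMDiffAt (𝓡 (d + 1)) (cylModel d) ∞ (cylParam L x) y := by
  have h1 : ContDiff ℝ ∞ fun y => (cylCoord d y).1 := by fun_prop
  have h2 : ContDiff ℝ ∞ fun y => (cylCoord d y).2 := by fun_prop
  have h3 : ContMDiffAt (𝓡 d) (𝓡 d) ∞ (extChartAt (𝓡 d) x).symm (cylCoord d y).2 :=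
    (contMDiffOn_extChartAt_symm x).contMDiffAt ((isOpen_extChartAt_target x).mem_nhds hy)
  exact h1.contMDiff.contMDiffAt.prodMk
    (ContMDiffAt.comp (g := (extChartAt (𝓡 d) x).symm) y h3 h2.contMDiff.contMDiffAt)

theorem mfderiv_cylParam {x : L} {y : EuclideanSpace ℝ (Fin (d + 1))}
    (hy : (cylCoord d y).2 ∈ (extChartAt (𝓡 d) x).target) (v : EuclideanSpace ℝ (Fin (d + 1))) :
    (mfderiv (𝓡 (d + 1)) (cylModel d) (cylParam L x) y v : ℝ × EuclideanSpace ℝ (Fin d))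
      = ((cylCoord d v).1,
        mfderiv (𝓡 d) (𝓡 d) (extChartAt (𝓡 d) x).symm (cylCoord d y).2 (cylCoord d v).2) := by
  let P1 : EuclideanSpace ℝ (Fin (d + 1)) →L[ℝ] ℝ :=
    (ContinuousLinearMap.fst ℝ ℝ _).comp (cylCoord d).toContinuousLinearMap
  let P2 : EuclideanSpace ℝ (Fin (d + 1)) →L[ℝ] EuclideanSpace ℝ (Fin d) :=
    (ContinuousLinearMap.snd ℝ ℝ _).comp (cylCoord d).toContinuousLinearMap
  have h1 : MDifferentiableAt (𝓡 (d + 1)) 𝓘(ℝ, ℝ) P1 y := P1.differentiableAt.mdifferentiableAt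
  have h2 : MDifferentiableAt (𝓡 (d + 1)) (𝓡 d) P2 y := P2.differentiableAt.mdifferentiableAt
  have h3 : MDifferentiableAt (𝓡 d) (𝓡 d) (extChartAt (𝓡 d) x).symm (P2 y) :=
    ((contMDiffOn_extChartAt_symm (n := ∞) x).contMDiffAt
      ((isOpen_extChartAt_target x).mem_nhds hy)).mdifferentiableAt (by simp)
  have h4 : mfderiv (𝓡 (d + 1)) (cylModel d) (cylParam L x) y
      = (mfderiv (𝓡 (d + 1)) 𝓘(ℝ, ℝ) P1 y).prod
        (mfderiv (𝓡 (d + 1)) (𝓡 d) ((extChartAt (𝓡 d) x).symm ∘ P2) y) :=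
    mfderiv_prodMk h1 (h3.comp y h2)
  have h5 := mfderiv_comp y h3 h2
  rw [mfderiv_eq_fderiv, P2.fderiv] at h5
  rw [mfderiv_eq_fderiv, P1.fderiv, h5] at h4
  exact congrArg (fun D : EuclideanSpace ℝ (Fin (d + 1)) →L[ℝ] ℝ × EuclideanSpace ℝ (Fin d) => D v) h4

/-- The parametrization of the cylindrical end by `ℝ` times a chart of the cross-section. -/
def endParam (A : ACylStructure d L M) (x : L) (y : EuclideanSpace ℝ (Fin (d + 1))) : M :=
  A.Φ (cylParam L x y)

/-- Far out, the exponentially small error is below one half of `g_cyl`, uniformly over the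
cross-section. -/
theorem ACylStructure.exists_half_bound (A : ACylStructure d L M) :
    ∃ T : ℝ, 0 ≤ T ∧ ∀ s, T < s → ∀ x : L, ∀ V : ℝ × EuclideanSpace ℝ (Fin d),
      2⁻¹ * cylMetric d A.gL (s, x) V V ≤
        ‖mfderiv (cylModel d) (𝓡 (d + 1)) A.Φ (s, x) V‖ ^ 2 ∧
      ‖mfderiv (cylModel d) (𝓡 (d + 1)) A.Φ (s, x) V‖ ^ 2 ≤
        2 * cylMetric d A.gL (s, x) V V := by
  obtain ⟨C, hC⟩ := A.decay 0
  have hlim : Tendsto (fun s : ℝ => C * Real.exp (-A.δ * s)) atTop (𝓝 0) := by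
    have h1 : Tendsto (fun s : ℝ => A.δ * s) atTop atTop := tendsto_id.const_mul_atTop A.δ_pos
    have := (Real.tendsto_exp_neg_atTop_nhds_zero.comp h1).const_mul C
    simpa [Function.comp_def, neg_mul] using this
  obtain ⟨T, hT⟩ := eventually_atTop.1
    (hC.and (hlim.eventually_lt_const (by norm_num : (0 : ℝ) < 2⁻¹)))
  refine ⟨max T 0, le_max_right _ _, fun s hs x V => ?_⟩
  obtain ⟨h1, h2⟩ := hT s ((le_max_left _ _).trans hs.le)
  have h3 := (h1 x).trans h2.le
  have h4 := abs_sq_norm_mfderiv_sub_cylMetric_le A.gL A.Φ (s, x) V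
  have hnn : 0 ≤ cylMetric d A.gL (s, x) V V := by
    rcases eq_or_ne V 0 with h | h
    · rw [h, cylMetric_apply]
      have : A.gL.inner x (0 : EuclideanSpace ℝ (Fin d)) (0 : EuclideanSpace ℝ (Fin d)) = 0 :=
        map_zero (A.gL.inner x _)
      simp [this]
    · exact (cylMetric_self_pos A.gL (s, x) h).le
  have h5 := abs_le.1 (h4.trans (mul_le_mul_of_nonneg_right h3 hnn))
  constructor <;> linarith [h5.1, h5.2]

/-- The constants depend on the chart of `L` but not on the height along the axis. One
parametrization covers a whole half-infinite strip, which axial translation maps into itself. -/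
theorem ACylStructure.exists_isBilipParam_endParam [IsManifold (𝓡 (d + 1)) ∞ M]
    (A : ACylStructure d L M) :
    ∃ T : ℝ, 0 ≤ T ∧ ∀ x : L, ∃ r k K : ℝ, 0 < r ∧
      Metric.ball (extChartAt (𝓡 d) x x) r ⊆ (extChartAt (𝓡 d) x).target ∧
      IsBilipParam (endParam A x)
        (cylCoord d ⁻¹' (Ioi T ×ˢ Metric.ball (extChartAt (𝓡 d) x x) r)) k K := by
  obtain ⟨T, hT0, hT⟩ := A.exists_half_bound
  refine ⟨T, hT0, fun x => ?_⟩
  obtain ⟨k, K, hk, hK, hev⟩ := exists_bounds_metric_extChartAt_symm A.gL x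
  obtain ⟨r, hr, hsub⟩ := Metric.mem_nhds_iff.1
    (inter_mem hev (extChartAt_target_mem_nhds (I := 𝓡 d) x))
  set B := Metric.ball (extChartAt (𝓡 d) x x) r
  set Ω := cylCoord d ⁻¹' (Ioi T ×ˢ B)
  have hΩo : IsOpen Ω := (isOpen_Ioi.prod Metric.isOpen_ball).preimage (cylCoord d).continuous
  have hsrc : ∀ y ∈ Ω, A.Φ.source ∈ 𝓝 (cylParam L x y) := by
    intro y hy
    rw [A.source_eq]
    exact prod_mem_nhds (Ici_mem_nhds (hT0.trans_lt hy.1)) univ_mem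
  have hΦ : ∀ y ∈ Ω, ContMDiffAt (cylModel d) (𝓡 (d + 1)) ∞ A.Φ (cylParam L x y) := fun y hy =>
    A.contMDiffOn.contMDiffAt (hsrc y hy)
  have hκ : ∀ y ∈ Ω, ContMDiffAt (𝓡 (d + 1)) (cylModel d) ∞ (cylParam L x) y := fun y hy =>
    contMDiffAt_cylParam (hsub hy.2).2
  have hderiv : ∀ y ∈ Ω, ∀ v : EuclideanSpace ℝ (Fin (d + 1)),
      (mfderiv (𝓡 (d + 1)) (𝓡 (d + 1)) (endParam A x) y v : EuclideanSpace ℝ (Fin (d + 1)))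
      = mfderiv (cylModel d) (𝓡 (d + 1)) A.Φ (cylParam L x y)
        (mfderiv (𝓡 (d + 1)) (cylModel d) (cylParam L x) y v) := fun y hy v =>
    congrArg (fun D : EuclideanSpace ℝ (Fin (d + 1)) →L[ℝ] EuclideanSpace ℝ (Fin (d + 1)) => D v)
      (mfderiv_comp y ((hΦ y hy).mdifferentiableAt (by simp)) ((hκ y hy).mdifferentiableAt (by simp)))
  have hnorm : ∀ y ∈ Ω, ∀ v : EuclideanSpace ℝ (Fin (d + 1)),
      ‖mfderiv (𝓡 (d + 1)) (𝓡 (d + 1)) (endParam A x) y v‖ ^ 2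
      = ‖mfderiv (cylModel d) (𝓡 (d + 1)) A.Φ (cylParam L x y)
        (mfderiv (𝓡 (d + 1)) (cylModel d) (cylParam L x) y v)‖ ^ 2 := by
    intro y hy v
    rw [← real_inner_self_eq_norm_sq, ← real_inner_self_eq_norm_sq]
    exact congrArg (fun w : EuclideanSpace ℝ (Fin (d + 1)) =>
      metricTensor (d + 1) (A.Φ (cylParam L x y)) w w) (hderiv y hy v)
  set a := min 1 k
  set b := max 1 K
  have ha : 0 < a := by positivity
  have hb : 0 < b := by positivity
  have hΛ : ∀ v, ‖v‖ ≤ ‖(cylCoord d).symm.toContinuousLinearMap‖ * ‖cylCoord d v‖ := fun v => by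
    simpa using (cylCoord d).symm.toContinuousLinearMap.le_opNorm (cylCoord d v)
  have hΛ' : ∀ v, ‖cylCoord d v‖ ≤ ‖(cylCoord d).toContinuousLinearMap‖ * ‖v‖ := fun v =>
    (cylCoord d).toContinuousLinearMap.le_opNorm v
  -- `cylCoord` is an arbitrary linear isomorphism, so its distortion enters the constants. Adding
  -- `1` makes `l` and `l'` positive.
  set l := ‖(cylCoord d).symm.toContinuousLinearMap‖ + 1
  set l' := ‖(cylCoord d).toContinuousLinearMap‖ + 1
  have hl : 0 < l := by positivity
  have hl' : 0 < l' := by positivity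
  have hmet : ∀ y ∈ Ω, ∀ v : EuclideanSpace ℝ (Fin (d + 1)),
      (a * ‖cylCoord d v‖) ^ 2 ≤ cylMetric d A.gL (cylParam L x y)
        (mfderiv (𝓡 (d + 1)) (cylModel d) (cylParam L x) y v)
        (mfderiv (𝓡 (d + 1)) (cylModel d) (cylParam L x) y v) ∧
      cylMetric d A.gL (cylParam L x y)
        (mfderiv (𝓡 (d + 1)) (cylModel d) (cylParam L x) y v)
        (mfderiv (𝓡 (d + 1)) (cylModel d) (cylParam L x) y v) ≤ 2 * (b * ‖cylCoord d v‖) ^ 2 := by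
    intro y hy v
    set η := cylCoord d v
    have e1 : cylMetric d A.gL (cylParam L x y)
        (mfderiv (𝓡 (d + 1)) (cylModel d) (cylParam L x) y v)
        (mfderiv (𝓡 (d + 1)) (cylModel d) (cylParam L x) y v) = η.1 * η.1
        + A.gL.inner ((extChartAt (𝓡 d) x).symm (cylCoord d y).2)
          (mfderiv (𝓡 d) (𝓡 d) (extChartAt (𝓡 d) x).symm (cylCoord d y).2 η.2)
          (mfderiv (𝓡 d) (𝓡 d) (extChartAt (𝓡 d) x).symm (cylCoord d y).2 η.2) :=
      (congrArg (fun V : ℝ × EuclideanSpace ℝ (Fin d) =>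
        cylMetric d A.gL (cylParam L x y) V V) (mfderiv_cylParam (hsub hy.2).2 v)).trans
        (cylMetric_apply A.gL (cylParam L x y) _ _)
    have e2 := (hsub hy.2).1 η.2
    rw [e1]
    have n1 : ‖η.1‖ ≤ ‖η‖ := norm_fst_le η
    have n2 : ‖η.2‖ ≤ ‖η‖ := norm_snd_le η
    have n3 : η.1 * η.1 = ‖η.1‖ ^ 2 := by rw [Real.norm_eq_abs, sq_abs, pow_two]
    rw [n3]
    constructor
    -- The norm on the product is the maximum norm, so the larger component alone gives the lower
    -- bound.
    · rcases le_total ‖η.1‖ ‖η.2‖ with hle | hle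
      · have : ‖η‖ = ‖η.2‖ := by rw [Prod.norm_def, max_eq_right hle]
        rw [this]
        have : (a * ‖η.2‖) ^ 2 ≤ (k * ‖η.2‖) ^ 2 := by
          gcongr; exact min_le_right _ _
        have := sq_nonneg ‖η.1‖
        linarith [e2.1]
      · have : ‖η‖ = ‖η.1‖ := by rw [Prod.norm_def, max_eq_left hle]
        rw [this]
        have : (a * ‖η.1‖) ^ 2 ≤ (1 * ‖η.1‖) ^ 2 := by
          gcongr; exact min_le_left _ _
        have := sq_nonneg (k * ‖η.2‖)
        linarith [e2.1]
    · have h1 : (1 * ‖η.1‖) ^ 2 ≤ (b * ‖η‖) ^ 2 := by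
        gcongr; exact le_max_left _ _
      have h2 : (K * ‖η.2‖) ^ 2 ≤ (b * ‖η‖) ^ 2 := by
        gcongr; exact le_max_right _ _
      linarith [e2.2]
  refine ⟨r, a / (2 * l), 2 * b * l', hr, fun y hy => (hsub hy).2, hΩo, ?_, ?_, by positivity,
    by positivity, ?_, ?_⟩
  · intro y hy
    exact (((hΦ y hy).comp y (hκ y hy)).of_le (by simp)).contMDiffWithinAt
  · intro y hy y' hy' h
    have h1 : cylParam L x y = cylParam L x y' :=
      A.Φ.injOn (mem_of_mem_nhds (hsrc y hy)) (mem_of_mem_nhds (hsrc y' hy')) h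
    have h2 := (extChartAt (𝓡 d) x).symm.injOn (hsub hy.2).2 (hsub hy'.2).2 (congrArg Prod.snd h1)
    have h3 : (cylCoord d y).1 = (cylCoord d y').1 := congrArg (Prod.fst : ℝ × L → ℝ) h1
    exact (cylCoord d).injective (Prod.ext h3 h2)
  · intro y hy v
    have h1 := (hT _ hy.1 (cylParam L x y).2
      (mfderiv (𝓡 (d + 1)) (cylModel d) (cylParam L x) y v)).1
    have h2 := (hmet y hy v).1
    have h3 : a / (2 * l) * ‖v‖ ≤ 2⁻¹ * (a * ‖cylCoord d v‖) := by
      have : ‖v‖ ≤ l * ‖cylCoord d v‖ := (hΛ v).trans (by gcongr; simp [l])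
      calc a / (2 * l) * ‖v‖ ≤ a / (2 * l) * (l * ‖cylCoord d v‖) := by gcongr
        _ = 2⁻¹ * (a * ‖cylCoord d v‖) := by field_simp
    refine h3.trans ((pow_le_pow_iff_left₀ (by positivity) (norm_nonneg _) two_ne_zero).1 ?_)
    have h4 := hnorm y hy v
    have h5 : (2⁻¹ * (a * ‖cylCoord d v‖)) ^ 2 = 4⁻¹ * (a * ‖cylCoord d v‖) ^ 2 := by ring
    have h6 := sq_nonneg (a * ‖cylCoord d v‖)
    calc (2⁻¹ * (a * ‖cylCoord d v‖)) ^ 2 ≤ 2⁻¹ * (a * ‖cylCoord d v‖) ^ 2 := by linarith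
      _ ≤ _ := mul_le_mul_of_nonneg_left h2 (by norm_num)
      _ ≤ _ := h1
      _ = _ := h4.symm
  · intro y hy v
    have h1 := (hT _ hy.1 (cylParam L x y).2
      (mfderiv (𝓡 (d + 1)) (cylModel d) (cylParam L x) y v)).2
    have h2 := (hmet y hy v).2
    have h3 : 2 * (b * ‖cylCoord d v‖) ≤ 2 * b * l' * ‖v‖ := by
      have : ‖cylCoord d v‖ ≤ l' * ‖v‖ := (hΛ' v).trans (by gcongr; simp [l'])
      calc 2 * (b * ‖cylCoord d v‖) ≤ 2 * (b * (l' * ‖v‖)) := by gcongr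
        _ = 2 * b * l' * ‖v‖ := by ring
    refine le_trans ((pow_le_pow_iff_left₀ (norm_nonneg _) (by positivity) two_ne_zero).1 ?_) h3
    have h4 := hnorm y hy v
    calc _ = _ := h4
      _ ≤ _ := h1
      _ ≤ _ := mul_le_mul_of_nonneg_left h2 (by norm_num)
      _ = _ := by ring

end EndParam

/-! ### The model weight -/

section CylWeight

/-- The model weight `e^{2s} / (1 + s²)` on the cylinder. -/
def cylWeight (s : ℝ) : ℝ := Real.exp (2 * s) / (1 + s ^ 2)

theorem cylWeight_pos (s : ℝ) : 0 < cylWeight s := by unfold cylWeight; positivity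

theorem continuous_cylWeight : Continuous cylWeight := by
  unfold cylWeight
  exact (by fun_prop : Continuous fun s : ℝ => Real.exp (2 * s)).div (by fun_prop)
    fun s => by positivity

theorem one_le_cylWeight {s : ℝ} (hs : 0 ≤ s) : 1 ≤ cylWeight s := by
  unfold cylWeight
  rw [one_le_div (by positivity)]
  have := Real.quadratic_le_exp_of_nonneg (x := 2 * s) (by linarith)
  nlinarith [sq_nonneg s]

/-- The exponential gains `e² ≥ 6`, while the denominator grows by at most the factor `3`, since
`2s² - 2s + 1 ≥ 0`. This growth drives the estimate on the end. -/
theorem cylWeight_le_half (s : ℝ) : cylWeight s ≤ 2⁻¹ * cylWeight (s + 1) := by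
  unfold cylWeight
  have h2 : (6 : ℝ) ≤ Real.exp 2 := by
    have h1 : (2.7 : ℝ) ≤ Real.exp 1 := by linarith [Real.exp_one_gt_d9]
    have : Real.exp 2 = Real.exp 1 * Real.exp 1 := by rw [← Real.exp_add]; norm_num
    rw [this]; nlinarith
  have hsplit : Real.exp (2 * (s + 1)) = Real.exp (2 * s) * Real.exp 2 := by
    rw [← Real.exp_add]; ring_nf
  rw [hsplit, ← mul_div_assoc, div_le_div_iff₀ (by positivity) (by positivity)]
  have hpos := Real.exp_pos (2 * s)
  have : 1 + (s + 1) ^ 2 ≤ 2⁻¹ * Real.exp 2 * (1 + s ^ 2) := by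
    nlinarith [sq_nonneg (2 * s - 1), sq_nonneg s]
  calc Real.exp (2 * s) * (1 + (s + 1) ^ 2)
      ≤ Real.exp (2 * s) * (2⁻¹ * Real.exp 2 * (1 + s ^ 2)) := by gcongr
    _ = _ := by ring

theorem cylWeight_le_three {s r : ℝ} (hr : r ∈ Icc (0 : ℝ) 1) :
    cylWeight s ≤ 3 * cylWeight (s + r) := by
  unfold cylWeight
  have h0 := hr.1
  have h1 := hr.2
  rw [← mul_div_assoc, div_le_div_iff₀ (by positivity) (by positivity)]
  have he : Real.exp (2 * s) ≤ Real.exp (2 * (s + r)) := Real.exp_le_exp.2 (by linarith)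
  have : 1 + (s + r) ^ 2 ≤ 3 * (1 + s ^ 2) := by nlinarith [sq_nonneg (s - r)]
  calc Real.exp (2 * s) * (1 + (s + r) ^ 2)
      ≤ Real.exp (2 * (s + r)) * (3 * (1 + s ^ 2)) := by gcongr
    _ = _ := by ring

end CylWeight

/-! ### Poincaré inequality on a strip and propagation of energy control -/

section Poincare

variable {m : ℕ} {M : Type*} [TopologicalSpace M] [T2Space M] [SecondCountableTopology M]
  [MeasurableSpace M] [BorelSpace M]
  [ChartedSpace (EuclideanSpace ℝ (Fin m)) M] [IsManifold (𝓡 m) 1 M]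
  [RiemannianBundle (fun p : M => TangentSpace (𝓡 m) p)]
  [IsContinuousRiemannianBundle (EuclideanSpace ℝ (Fin m)) (fun p : M => TangentSpace (𝓡 m) p)]

/-- Weighted comparison of the `L²`-norm of a function on a set with that on a translate of the set,
in a parametrization. -/
theorem IsBilipParam.lintegral_sq_le_translate {ψ : EuclideanSpace ℝ (Fin m) → M}
    {Ω B B' : Set (EuclideanSpace ℝ (Fin m))} {k K : ℝ} (hψ : IsBilipParam ψ Ω k K)
    {u : M → ℝ} (hu : ContMDiff (𝓡 m) 𝓘(ℝ, ℝ) 1 u)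
    (hB : MeasurableSet B) (hB' : MeasurableSet B') (hB'Ω : B' ⊆ Ω) {h : EuclideanSpace ℝ (Fin m)}
    (hBB' : ∀ y ∈ B, y + h ∈ B') (hBΩ : ∀ y ∈ B, ∀ s ∈ Icc (0 : ℝ) 1, y + s • h ∈ Ω)
    {W : EuclideanSpace ℝ (Fin m) → ENNReal} (hW : Measurable W) {θ c a b : ℝ}
    (ha : 0 ≤ a) (hb : 0 ≤ b) (hab : ∀ p q : ℝ, p ^ 2 ≤ a * q ^ 2 + b * (q - p) ^ 2)
    (hWθ : ∀ y ∈ B, W y ≤ ENNReal.ofReal θ * W (y + h))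
    (hWc : ∀ y ∈ B, ∀ s ∈ Icc (0 : ℝ) 1, W y ≤ ENNReal.ofReal c * W (y + s • h)) :
    ∫⁻ y in B, W y * ENNReal.ofReal (u (ψ y) ^ 2) ≤
      ENNReal.ofReal (a * θ) * (∫⁻ y in B', W y * ENNReal.ofReal (u (ψ y) ^ 2))
        + ENNReal.ofReal (b * c) * (ENNReal.ofReal ((K * ‖h‖) ^ 2) *
          ∫⁻ y in Ω, W y * ENNReal.ofReal (‖riemGradient m u (ψ y)‖ ^ 2)) := by
  classical
  have hv := hψ.contDiffOn_comp hu
  have hgrad := continuous_norm_sq_riemGradient hu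
  set G₀ : EuclideanSpace ℝ (Fin m) → ENNReal :=
    fun y => ENNReal.ofReal ((K * ‖h‖) ^ 2 * ‖riemGradient m u (ψ y)‖ ^ 2) with hG₀
  have hG₀c : ContinuousOn G₀ Ω := ENNReal.continuous_ofReal.comp_continuousOn
    (continuousOn_const.mul (hgrad.comp_continuousOn hψ.contMDiffOn.continuousOn))
  -- `G₀` is known to be continuous only on `Ω`, so it is replaced by zero elsewhere to be
  -- measurable.
  have hGm : Measurable (Ω.piecewise G₀ fun _ => 0) :=
    hG₀c.measurable_piecewise continuousOn_const hψ.isOpen.measurableSet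
  have key := ACyl.lintegral_sq_le_translate volume (v := fun y => u (ψ y)) hB hW
    ((hv.continuousOn.mono hB'Ω).aemeasurable hB') hGm hB' hψ.isOpen.measurableSet ha hb hab hBB' hBΩ
    hWθ hWc (fun y hy => ?_)
  · refine key.trans_eq ?_
    congr 2
    rw [← lintegral_const_mul' _ _ ENNReal.ofReal_ne_top]
    refine setLIntegral_congr_fun hψ.isOpen.measurableSet fun y hy => ?_
    simp only [piecewise_eq_of_mem _ _ _ hy, hG₀]
    rw [ENNReal.ofReal_mul (sq_nonneg _)]
    ring
  · refine (sq_sub_le_lintegral_of_contDiffOn hψ.isOpen hv (hBΩ y hy)).trans ?_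
    refine setLIntegral_mono' measurableSet_Ioc fun s hs => ?_
    have hs' := hBΩ y hy s (Ioc_subset_Icc_self hs)
    rw [piecewise_eq_of_mem _ _ _ hs']
    exact ENNReal.ofReal_le_ofReal (hψ.sq_fderiv_comp_le hu hs' h)

theorem riemGradient_eq_zero_of_notMem_tsupport {u : M → ℝ} {p : M} (hp : p ∉ tsupport u) :
    riemGradient m u p = 0 := by
  have h0 : u =ᶠ[𝓝 p] fun _ => 0 := notMem_tsupport_iff_eventuallyEq.1 hp
  have hd : mvfderiv (𝓡 m) u p = 0 := by
    ext v
    have h1 := h0.mfderiv_eq (I := 𝓡 m) (I' := 𝓘(ℝ, ℝ))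
    have h2 : (mfderiv (𝓡 m) 𝓘(ℝ, ℝ) u p : EuclideanSpace ℝ (Fin m) →L[ℝ] ℝ) = 0 :=
      h1.trans mfderiv_const
    exact congrArg (fun D : EuclideanSpace ℝ (Fin m) →L[ℝ] ℝ => D v) h2
  refine ext_inner_right ℝ fun v => ?_
  rw [inner_riemGradient, hd, inner_zero_left]
  rfl

theorem lintegral_lt_top_of_hasCompactSupport {F : M → ℝ} (hF : Continuous F)
    (hs : HasCompactSupport F) : ∫⁻ p, ENNReal.ofReal (F p) ∂(volumeMeasure m) < ⊤ := by
  have := isFiniteMeasureOnCompacts_volumeMeasure (m := m) (M := M)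
  have hi : Integrable F (volumeMeasure m) := hF.integrable_of_hasCompactSupport hs
  refine lt_of_le_of_lt (lintegral_mono fun p => ?_) hi.hasFiniteIntegral
  rw [← ofReal_norm]
  exact ENNReal.ofReal_le_ofReal (le_abs_self _)

/-- The weighted Poincaré inequality on a half-infinite end. -/
theorem IsBilipParam.poincare_end {ψ : EuclideanSpace ℝ (Fin m) → M}
    {Ω : Set (EuclideanSpace ℝ (Fin m))} {k K : ℝ} (hψ : IsBilipParam ψ Ω k K)
    {t : M → ℝ} (ht : Continuous t) {τ : EuclideanSpace ℝ (Fin m) → ℝ} (hτ : Continuous τ)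
    (htτ : ∀ y ∈ Ω, t (ψ y) = τ y) {h : EuclideanSpace ℝ (Fin m)}
    (hτh : ∀ y, ∀ s : ℝ, τ (y + s • h) = τ y + s)
    (hΩh : ∀ y ∈ Ω, ∀ s ∈ Icc (0 : ℝ) 1, y + s • h ∈ Ω) :
    ∃ C : ℝ, 0 ≤ C ∧ ∀ u : M → ℝ, ContMDiff (𝓡 m) 𝓘(ℝ, ℝ) 1 u → HasCompactSupport u →
      ∫⁻ p in ψ '' Ω, ENNReal.ofReal (cylWeight (t p)) * ENNReal.ofReal (u p ^ 2)
          ∂(volumeMeasure m) ≤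
        ENNReal.ofReal C * ∫⁻ p in ψ '' Ω, ENNReal.ofReal (cylWeight (t p)) *
          ENNReal.ofReal (‖riemGradient m u p‖ ^ 2) ∂(volumeMeasure m) := by
  have hk := hψ.k_pos
  have hK := hψ.K_pos
  -- `K ^ m` and `(k ^ m)⁻¹` come from passing to Lebesgue measure and back. The absorption of `X ≤
  -- (3/4) X + 9 Z` gives `36 = 4 · 9`.
  refine ⟨K ^ m * (36 * ((K * ‖h‖) ^ 2 * (k ^ m)⁻¹)), by positivity, fun u hu hsupp => ?_⟩
  set W : EuclideanSpace ℝ (Fin m) → ENNReal := fun y => ENNReal.ofReal (cylWeight (τ y)) with hWdef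
  have hW : Measurable W := by
    exact ENNReal.measurable_ofReal.comp (continuous_cylWeight.comp hτ).measurable
  have hgrad := continuous_norm_sq_riemGradient hu
  have hwt : Measurable fun p => ENNReal.ofReal (cylWeight (t p)) :=
    ENNReal.measurable_ofReal.comp (continuous_cylWeight.comp ht).measurable
  have hF1 : Measurable fun p => ENNReal.ofReal (cylWeight (t p)) * ENNReal.ofReal (u p ^ 2) :=
    hwt.mul (ENNReal.measurable_ofReal.comp (hu.continuous.pow 2).measurable)
  have hF2 : Measurable fun p =>
      ENNReal.ofReal (cylWeight (t p)) * ENNReal.ofReal (‖riemGradient m u p‖ ^ 2) :=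
    hwt.mul (ENNReal.measurable_ofReal.comp hgrad.measurable)
  set X := ∫⁻ y in Ω, W y * ENNReal.ofReal (u (ψ y) ^ 2) with hX
  set Y := ∫⁻ y in Ω, W y * ENNReal.ofReal (‖riemGradient m u (ψ y)‖ ^ 2) with hY
  have hXeq : X = ∫⁻ y in Ω, ENNReal.ofReal (cylWeight (t (ψ y))) * ENNReal.ofReal (u (ψ y) ^ 2) :=
    setLIntegral_congr_fun hψ.isOpen.measurableSet fun y hy => by simp only [hWdef, htτ y hy]
  have hYeq : Y = ∫⁻ y in Ω, ENNReal.ofReal (cylWeight (t (ψ y))) *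
      ENNReal.ofReal (‖riemGradient m u (ψ y)‖ ^ 2) :=
    setLIntegral_congr_fun hψ.isOpen.measurableSet fun y hy => by simp only [hWdef, htτ y hy]
  -- Compact support of `u` makes `X` finite, without which `(3/4) X` could not be subtracted.
  have hXtop : X ≠ ⊤ := by
    rw [hXeq]
    refine ((hψ.le_setLIntegral_image hF1).trans_lt (ENNReal.mul_lt_top ENNReal.ofReal_lt_top
      (lt_of_le_of_lt (setLIntegral_le_lintegral _ _) ?_))).ne
    have hcs : HasCompactSupport fun p => cylWeight (t p) * u p ^ 2 := by
      have : HasCompactSupport fun p => u p ^ 2 :=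
        hsupp.comp_left (g := fun x : ℝ => x ^ 2) (by simp)
      exact this.mul_left
    have := lintegral_lt_top_of_hasCompactSupport (m := m)
      ((continuous_cylWeight.comp ht).mul (hu.continuous.pow 2)) hcs
    simpa [ENNReal.ofReal_mul (cylWeight_pos _).le] using this
  have key := hψ.lintegral_sq_le_translate hu hψ.isOpen.measurableSet hψ.isOpen.measurableSet
    Subset.rfl (h := h) (fun y hy => by simpa using hΩh y hy 1 (by simp)) hΩh hW
    -- What matters is `a * θ = 3/4 < 1`. With `a = 2` the product would be `1` and absorption would
    -- fail.
    (θ := 2⁻¹) (c := 3) (a := 3 / 2) (b := 3) (by norm_num) (by norm_num)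
    (fun p q => by nlinarith [sq_nonneg (3 * q - 2 * p), sq_nonneg (p - q), sq_nonneg (3 * q - 2 * p)])
    (fun y _ => by
      have e := hτh y 1
      rw [one_smul] at e
      simp only [hWdef, e]
      rw [← ENNReal.ofReal_mul (by norm_num)]
      exact ENNReal.ofReal_le_ofReal (cylWeight_le_half _))
    (fun y _ s hs => by
      simp only [hWdef, hτh]
      rw [← ENNReal.ofReal_mul (by norm_num)]
      exact ENNReal.ofReal_le_ofReal (cylWeight_le_three hs))
  rw [← hX, ← hY] at key
  have habs : X ≤ ENNReal.ofReal 36 * (ENNReal.ofReal ((K * ‖h‖) ^ 2) * Y) := by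
    set Z := ENNReal.ofReal ((K * ‖h‖) ^ 2) * Y
    rcases eq_or_ne Z ⊤ with hZ | hZ
    · rw [hZ, ENNReal.mul_top (by simp)]; exact le_top
    rw [← ENNReal.ofReal_toReal hXtop, ← ENNReal.ofReal_toReal hZ] at key ⊢
    have h0 : 0 ≤ X.toReal := ENNReal.toReal_nonneg
    have h1 : 0 ≤ Z.toReal := ENNReal.toReal_nonneg
    rw [← ENNReal.ofReal_mul (by norm_num), ← ENNReal.ofReal_mul (by norm_num),
      ← ENNReal.ofReal_add (by positivity) (by positivity),
      ENNReal.ofReal_le_ofReal_iff (by positivity)] at key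
    rw [← ENNReal.ofReal_mul (by norm_num)]
    exact ENNReal.ofReal_le_ofReal (by linarith)
  calc ∫⁻ p in ψ '' Ω, ENNReal.ofReal (cylWeight (t p)) * ENNReal.ofReal (u p ^ 2) ∂(volumeMeasure m)
      ≤ ENNReal.ofReal (K ^ m) * X := by rw [hXeq]; exact hψ.setLIntegral_image_le hF1
    _ ≤ ENNReal.ofReal (K ^ m) * (ENNReal.ofReal 36 * (ENNReal.ofReal ((K * ‖h‖) ^ 2) * Y)) := by
        gcongr
    _ ≤ ENNReal.ofReal (K ^ m) * (ENNReal.ofReal 36 * (ENNReal.ofReal ((K * ‖h‖) ^ 2) *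
          (ENNReal.ofReal ((k ^ m)⁻¹) * ∫⁻ p in ψ '' Ω, ENNReal.ofReal (cylWeight (t p)) *
          ENNReal.ofReal (‖riemGradient m u p‖ ^ 2) ∂(volumeMeasure m)))) := by
        gcongr
        rw [hYeq]; exact hψ.le_setLIntegral_image hF2
    _ = _ := by
        rw [ENNReal.ofReal_mul (by positivity), ENNReal.ofReal_mul (by positivity),
          ENNReal.ofReal_mul (by positivity)]
        ring

/-- The `L²`-norm on `N` is controlled by the weighted Dirichlet energy. -/
def EnergyControls (m : ℕ) {M : Type*} [TopologicalSpace M] [MeasurableSpace M]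
    [ChartedSpace (EuclideanSpace ℝ (Fin m)) M]
    [RiemannianBundle (fun p : M => TangentSpace (𝓡 m) p)] (w : M → ℝ) (N : Set M) : Prop :=
  ∃ C : ℝ, 0 ≤ C ∧ ∀ u : M → ℝ, ContMDiff (𝓡 m) 𝓘(ℝ, ℝ) 1 u → HasCompactSupport u →
    ∫⁻ p in N, ENNReal.ofReal (u p ^ 2) ∂(volumeMeasure m) ≤
      ENNReal.ofReal C * ∫⁻ p, ENNReal.ofReal (w p) * ENNReal.ofReal (‖riemGradient m u p‖ ^ 2)
        ∂(volumeMeasure m)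

theorem EnergyControls.mono {w : M → ℝ} {N N' : Set M} (h : EnergyControls m w N) (hN : N' ⊆ N) :
    EnergyControls m w N' := by
  obtain ⟨C, hC, hC'⟩ := h
  exact ⟨C, hC, fun u hu hs => (lintegral_mono_set hN).trans (hC' u hu hs)⟩

theorem EnergyControls.union {w : M → ℝ} {N N' : Set M} (h : EnergyControls m w N)
    (h' : EnergyControls m w N') : EnergyControls m w (N ∪ N') := by
  obtain ⟨C, hC, hCu⟩ := h
  obtain ⟨C', hC', hCu'⟩ := h'
  refine ⟨C + C', add_nonneg hC hC', fun u hu hs => ?_⟩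
  rw [ENNReal.ofReal_add hC hC', add_mul]
  exact (lintegral_union_le _ _ _).trans (add_le_add (hCu u hu hs) (hCu' u hu hs))

/-- Control of the `L²`-norm by the energy spreads to limit points. -/
theorem energyControls_nhds_of_mem_closure {w : M → ℝ} (hw : Continuous w) (hpos : ∀ p, 0 < w p)
    {p : M} (hp : p ∈ closure {q | ∃ N ∈ 𝓝 q, EnergyControls m w N}) :
    ∃ N ∈ 𝓝 p, EnergyControls m w N := by
  obtain ⟨k, K, r, hr, htgt, hψ⟩ := exists_isBilipParam (m := m) p
  set e := extChartAt (𝓡 m) p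
  -- Near `p` the weight is bounded below, so the plain Dirichlet energy is dominated by the
  -- weighted one.
  have hwev : ∀ᶠ y in 𝓝 (e p), w p / 2 < w (e.symm y) := by
    have hc : ContinuousAt (fun y => w (e.symm y)) (e p) :=
      hw.continuousAt.comp (continuousAt_extChartAt_symm p)
    refine hc.eventually (lt_mem_nhds ?_)
    simp only [e, extChartAt_to_inv]
    linarith [hpos p]
  obtain ⟨r', hr', hsub⟩ := Metric.mem_nhds_iff.1 (inter_mem hwev (Metric.ball_mem_nhds (e p) hr))
  set Ω := Metric.ball (e p) r' with hΩ
  have hψΩ : IsBilipParam e.symm Ω k K := hψ.mono Metric.isOpen_ball fun y hy => (hsub hy).2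
  have hΩt : Ω ⊆ e.target := fun y hy => htgt (hsub hy).2
  have himg : ∀ s, 0 < s → Metric.ball (e p) s ⊆ e.target → e.symm '' Metric.ball (e p) s ∈ 𝓝 p := by
    intro s hs hst
    rw [e.symm_image_eq_source_inter_preimage hst]
    exact inter_mem (extChartAt_source_mem_nhds p)
      ((continuousAt_extChartAt p).preimage_mem_nhds (Metric.ball_mem_nhds _ hs))
  obtain ⟨_, ⟨y₀, hy₀, rfl⟩, N, hN, C, hC, hCu⟩ := mem_closure_iff_nhds.1 hp _ (himg r' hr' hΩt)
  have hcont : ContinuousAt e.symm y₀ :=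
    (continuousOn_extChartAt_symm p).continuousAt ((isOpen_extChartAt_target p).mem_nhds (hΩt hy₀))
  obtain ⟨ρ₀, hρ₀, hρsub⟩ := Metric.mem_nhds_iff.1
    (inter_mem (hcont.preimage_mem_nhds hN) (Metric.isOpen_ball.mem_nhds hy₀))
  set ρ := min ρ₀ r'
  have hρ : 0 < ρ := lt_min hρ₀ hr'
  have hB' : Metric.ball y₀ ρ ⊆ e.symm ⁻¹' N ∩ Ω :=
    (Metric.ball_subset_ball (min_le_left _ _)).trans hρsub
  have hB : Metric.ball (e p) ρ ⊆ Ω := Metric.ball_subset_ball (min_le_right _ _)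
  -- This translation carries a small ball about `p` onto one about `y₀`, where control is already
  -- known. Convexity of the chart ball `Ω` keeps the segments inside it.
  set h := y₀ - e p with hh
  have hBB' : ∀ y ∈ Metric.ball (e p) ρ, y + h ∈ Metric.ball y₀ ρ := by
    intro y hy
    rw [Metric.mem_ball, dist_eq_norm] at hy ⊢
    have : y + h - y₀ = y - e p := by rw [hh]; abel
    rwa [this]
  have hBΩ : ∀ y ∈ Metric.ball (e p) ρ, ∀ s ∈ Icc (0 : ℝ) 1, y + s • h ∈ Ω := by
    intro y hy s hs
    have := (convex_ball (e p) r') (hB hy) (hB' (hBB' y hy)).2 (sub_nonneg.2 hs.2) hs.1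
      (by ring : 1 - s + s = 1)
    have heq : (1 - s) • y + s • (y + h) = y + s • h := by module
    rwa [heq] at this
  have hk := hψ.k_pos
  have hK := hψ.K_pos
  have hwp := hpos p
  refine ⟨_, himg ρ hρ (hB.trans hΩt), K ^ m * (2 * ((k ^ m)⁻¹ * C) +
    2 * ((K * ‖h‖) ^ 2 * ((k ^ m)⁻¹ * (2 / w p)))), by positivity, fun u hu hs => ?_⟩
  have hgrad := continuous_norm_sq_riemGradient hu
  have hF1 : Measurable fun p => ENNReal.ofReal (u p ^ 2) :=
    ENNReal.measurable_ofReal.comp (hu.continuous.pow 2).measurable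
  have hF2 : Measurable fun p => ENNReal.ofReal (‖riemGradient m u p‖ ^ 2) :=
    ENNReal.measurable_ofReal.comp hgrad.measurable
  set D := ∫⁻ p, ENNReal.ofReal (w p) * ENNReal.ofReal (‖riemGradient m u p‖ ^ 2)
    ∂(volumeMeasure m) with hD
  have key := hψΩ.lintegral_sq_le_translate hu Metric.isOpen_ball.measurableSet
    Metric.isOpen_ball.measurableSet (fun y hy => (hB' hy).2) hBB' hBΩ
    -- Nothing is absorbed here, since the translated ball is already controlled, so `p² ≤ 2q² + 2(q
    -- - p)²` is good enough.
    (W := fun _ => 1) measurable_const (θ := 1) (c := 1) (a := 2) (b := 2) (by norm_num)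
    (by norm_num) (fun p q => by nlinarith [sq_nonneg (2 * q - p)]) (by simp) (by simp)
  simp only [one_mul, mul_one] at key
  have e1 : ∫⁻ y in Metric.ball y₀ ρ, ENNReal.ofReal (u (e.symm y) ^ 2) ≤
      ENNReal.ofReal ((k ^ m)⁻¹) * (ENNReal.ofReal C * D) := by
    refine ((hψΩ.mono Metric.isOpen_ball fun y hy => (hB' hy).2).le_setLIntegral_image hF1).trans ?_
    gcongr
    refine (lintegral_mono_set ?_).trans (hCu u hu hs)
    exact image_subset_iff.2 fun y hy => (hB' hy).1
  have e2 : ∫⁻ y in Ω, ENNReal.ofReal (‖riemGradient m u (e.symm y)‖ ^ 2) ≤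
      ENNReal.ofReal ((k ^ m)⁻¹) * (ENNReal.ofReal (2 / w p) * D) := by
    refine (hψΩ.le_setLIntegral_image hF2).trans ?_
    gcongr
    rw [hD, ← lintegral_const_mul' _ _ ENNReal.ofReal_ne_top]
    refine le_trans ?_ (setLIntegral_le_lintegral (e.symm '' Ω) _)
    refine setLIntegral_mono' hψΩ.measurableSet_image ?_
    rintro _ ⟨y, hy, rfl⟩
    rw [← mul_assoc, ← ENNReal.ofReal_mul (by positivity)]
    refine le_mul_of_one_le_left zero_le ?_
    rw [← ENNReal.ofReal_one]
    refine ENNReal.ofReal_le_ofReal ?_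
    have : w p / 2 < w (e.symm y) := (hsub hy).1
    rw [div_mul_eq_mul_div, one_le_div hwp]
    linarith
  calc ∫⁻ q in e.symm '' Metric.ball (e p) ρ, ENNReal.ofReal (u q ^ 2) ∂(volumeMeasure m)
      ≤ ENNReal.ofReal (K ^ m) * ∫⁻ y in Metric.ball (e p) ρ, ENNReal.ofReal (u (e.symm y) ^ 2) :=
        (hψΩ.mono Metric.isOpen_ball hB).setLIntegral_image_le hF1
    _ ≤ ENNReal.ofReal (K ^ m) * (ENNReal.ofReal 2 * (ENNReal.ofReal ((k ^ m)⁻¹) *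
          (ENNReal.ofReal C * D)) + ENNReal.ofReal 2 * (ENNReal.ofReal ((K * ‖h‖) ^ 2) *
          (ENNReal.ofReal ((k ^ m)⁻¹) * (ENNReal.ofReal (2 / w p) * D)))) := by
        gcongr
        refine key.trans ?_
        gcongr
    _ = _ := by
        rw [ENNReal.ofReal_mul (by positivity), ENNReal.ofReal_add (by positivity) (by positivity),
          ENNReal.ofReal_mul (by positivity), ENNReal.ofReal_mul (by positivity),
          ENNReal.ofReal_mul (by positivity), ENNReal.ofReal_mul (by positivity),
          ENNReal.ofReal_mul (by positivity)]
        ring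

/-- The points with a controlled neighbourhood form a nonempty clopen set, hence all of `M`. Control
on a compact set follows from a finite cover. -/
theorem energyControls_of_isCompact [PreconnectedSpace M] {w : M → ℝ} (hw : Continuous w)
    (hpos : ∀ p, 0 < w p) {O : Set M} (hO : IsOpen O) (hne : O.Nonempty)
    (hOw : EnergyControls m w O) {Q : Set M} (hQ : IsCompact Q) : EnergyControls m w Q := by
  set S : Set M := {q | ∃ N ∈ 𝓝 q, EnergyControls m w N}
  have hSo : IsOpen S := by
    rw [isOpen_iff_mem_nhds]
    rintro q ⟨N, hN, hNw⟩
    filter_upwards [eventually_mem_nhds_iff.2 hN] with z hz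
    exact ⟨N, hz, hNw⟩
  have hSc : IsClosed S := isClosed_of_closure_subset fun p hp =>
    energyControls_nhds_of_mem_closure hw hpos hp
  obtain ⟨x, hx⟩ := hne
  have hS : S = univ := IsClopen.eq_univ ⟨hSc, hSo⟩ ⟨x, O, hO.mem_nhds hx, hOw⟩
  refine hQ.induction_on (p := EnergyControls m w) ?_ (fun s t hst ht => ht.mono hst)
    (fun s t hs ht => hs.union ht) fun x _ => ?_
  · exact ⟨0, le_rfl, fun u _ _ => by simp⟩
  · obtain ⟨N, hN, hNw⟩ : x ∈ S := hS ▸ mem_univ x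
    exact ⟨N, mem_nhdsWithin_of_mem_nhds hN, hNw⟩

end Poincare

/-! ### Comparison with the model weight -/

section WeightComparison

/-- If `f` is at bounded distance from `2s`, the weight `e^f / (f + c)²` is comparable to the model
weight. -/
theorem weight_comparison {C₀ c s f : ℝ} (hC₀ : 0 ≤ C₀) (hc : 0 < c) (hs : C₀ + 1 ≤ s)
    (hf : |f - 2 * s| ≤ C₀) :
    Real.exp (-C₀) / (2 * (2 + C₀ + c) ^ 2) * cylWeight s ≤ Real.exp f / (f + c) ^ 2 ∧
      Real.exp f / (f + c) ^ 2 ≤ Real.exp C₀ * cylWeight s := by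
  obtain ⟨h1, h2⟩ := abs_le.1 hf
  -- This is where `s ≥ C₀ + 1` enters: `f ≥ 2s - C₀ ≥ s + 1`.
  have hlow : 1 + s ≤ f + c := by linarith
  have hs0 : 0 ≤ s := by linarith
  have hup : f + c ≤ (2 + C₀ + c) * (1 + s) := by nlinarith
  have hfc : 0 < f + c := by linarith
  have e1 : (f + c) ^ 2 ≤ 2 * (2 + C₀ + c) ^ 2 * (1 + s ^ 2) := by
    calc (f + c) ^ 2 ≤ ((2 + C₀ + c) * (1 + s)) ^ 2 := by gcongr
      _ = (2 + C₀ + c) ^ 2 * (1 + s) ^ 2 := by ring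
      _ ≤ (2 + C₀ + c) ^ 2 * (2 * (1 + s ^ 2)) := by
          gcongr; nlinarith [sq_nonneg (1 - s)]
      _ = _ := by ring
  have e2 : 1 + s ^ 2 ≤ (f + c) ^ 2 := by nlinarith
  have x1 : Real.exp (-C₀) * Real.exp (2 * s) ≤ Real.exp f := by
    rw [← Real.exp_add]; exact Real.exp_le_exp.2 (by linarith)
  have x2 : Real.exp f ≤ Real.exp C₀ * Real.exp (2 * s) := by
    rw [← Real.exp_add]; exact Real.exp_le_exp.2 (by linarith)
  unfold cylWeight
  constructor
  · rw [div_mul_div_comm]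
    gcongr
  · rw [← mul_div_assoc]
    gcongr

end WeightComparison

/-! ### Compact core, finite cover and Poincaré inequality of the end -/

section Geometry

variable {d : ℕ} {L : Type*} [TopologicalSpace L] [CompactSpace L]
    [ChartedSpace (EuclideanSpace ℝ (Fin d)) L] [IsManifold (𝓡 d) ∞ L]
    {M : Type*} [MetricSpace M]
    [ChartedSpace (EuclideanSpace ℝ (Fin (d + 1))) M] [IsManifold (𝓡 (d + 1)) ∞ M]
    [RiemannianBundle (fun p : M => TangentSpace (𝓡 (d + 1)) p)]
    (A : ACylStructure d L M)

theorem ACylStructure.exists_eq_of_notMem {p : M} (hp : p ∉ A.U) :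
    ∃ s : ℝ, 0 ≤ s ∧ ∃ x : L, A.Φ (s, x) = p := by
  have hp' : p ∈ A.Φ.target := by rw [A.target_eq]; exact hp
  have h := A.Φ.map_target hp'
  rw [A.source_eq] at h
  exact ⟨(A.Φ.symm p).1, h.1, (A.Φ.symm p).2, A.Φ.right_inv hp'⟩

/-- A bounded set lies in a closed ball, which is compact by the Hopf–Rinow theorem. -/
theorem ACylStructure.isCompact_closure_U [CompleteSpace M] [IsRiemannianManifold (𝓡 (d + 1)) M] :
    IsCompact (closure A.U) := by
  have : LocallyCompactSpace M := Manifold.locallyCompact_of_finiteDimensional (𝓡 (d + 1))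
  rcases A.U.eq_empty_or_nonempty with h | ⟨x, _⟩
  · simp [h]
  · obtain ⟨R, hR⟩ := A.isBounded_U.subset_closedBall x
    exact ((approxLength_of_isRiemannianManifold (𝓡 (d + 1))).isCompact_closedBall x
      R).of_isClosed_subset isClosed_closure (closure_minimal hR Metric.isClosed_closedBall)

theorem ACylStructure.isCompact_image_Icc (T : ℝ) :
    IsCompact (A.Φ '' (Icc 0 T ×ˢ univ)) := by
  refine (isCompact_Icc.prod isCompact_univ).image_of_continuousOn (A.contMDiffOn.continuousOn.mono ?_)
  rw [A.source_eq]
  exact prod_mono Icc_subset_Ici_self Subset.rfl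

theorem covNorm₀_zero (u : M → ℝ) (p : M) :
    covNorm₀ (𝓡 (d + 1)) (stdBasis (d + 1)) (metricTensor (d + 1)) u 0 p = |u p| := by
  unfold covNorm₀ iterCovDeriv tensorNorm
  rw [extChartAt_to_inv]
  simp [Real.sqrt_mul_self_eq_abs]

/-- The factor `e^{ε t}` is at least `1` where `t ≥ 0`, so the weighted bound is in particular a
plain one. Applied to `f - 2t`, it gives the bounded distance that the weight comparison needs. -/
theorem MemWeighted.exists_abs_le {t u : M → ℝ} {k : ℕ} {ε : ℝ} (h : MemWeighted d t k ε u)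
    (hε : 0 < ε) : ∃ C : ℝ, 0 ≤ C ∧ ∀ p, 0 ≤ t p → |u p| ≤ C := by
  obtain ⟨C, hC⟩ := h.2 0 (Nat.zero_le _)
  refine ⟨max C 0, le_max_right _ _, fun p hp => ?_⟩
  have h1 := hC p
  rw [covNorm₀_zero] at h1
  have h2 : 1 ≤ Real.exp (ε * t p) := Real.one_le_exp (by positivity)
  have h3 : |u p| ≤ Real.exp (ε * t p) * |u p| := le_mul_of_one_le_left (abs_nonneg _) h2
  exact (h3.trans h1).trans (le_max_left _ _)

/-- The cylindrical end is covered by finitely many parametrizations of bounded distortion. -/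
theorem ACylStructure.exists_finite_cover :
    ∃ T : ℝ, 0 ≤ T ∧ ∀ T', T ≤ T' → ∃ s : Finset L, ∃ r k K : L → ℝ,
      (∀ x, IsBilipParam (endParam A x)
        (cylCoord d ⁻¹' (Ioi T' ×ˢ Metric.ball (extChartAt (𝓡 d) x x) (r x))) (k x) (K x)) ∧
      ∀ τ z, T' < τ → ∃ x ∈ s, A.Φ (τ, z) ∈ endParam A x ''
        (cylCoord d ⁻¹' (Ioi T' ×ˢ Metric.ball (extChartAt (𝓡 d) x x) (r x))) := by
  obtain ⟨T, hT0, hT⟩ := A.exists_isBilipParam_endParam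
  choose r k K hr ht hψ using hT
  refine ⟨T, hT0, fun T' hT' => ?_⟩
  obtain ⟨s, hs⟩ := finite_cover_nhds (X := L)
    (U := fun x => (extChartAt (𝓡 d) x).symm '' Metric.ball (extChartAt (𝓡 d) x x) (r x)) (fun x => by
      rw [(extChartAt (𝓡 d) x).symm_image_eq_source_inter_preimage (ht x)]
      exact inter_mem (extChartAt_source_mem_nhds x)
        ((continuousAt_extChartAt x).preimage_mem_nhds (Metric.ball_mem_nhds _ (hr x))))
  refine ⟨s, r, k, K, fun x => (hψ x).mono ?_ ?_, fun τ z hτ => ?_⟩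
  · exact (isOpen_Ioi.prod Metric.isOpen_ball).preimage (cylCoord d).continuous
  · exact preimage_mono (prod_mono (Ioi_subset_Ioi hT') Subset.rfl)
  · have hz : z ∈ ⋃ x ∈ s, (extChartAt (𝓡 d) x).symm ''
        Metric.ball (extChartAt (𝓡 d) x x) (r x) := hs ▸ mem_univ z
    obtain ⟨x, hx, y, hy, rfl⟩ := mem_iUnion₂.1 hz
    refine ⟨x, hx, (cylCoord d).symm (τ, y), ?_, ?_⟩
    · simp only [mem_preimage, ContinuousLinearEquiv.apply_symm_apply]
      exact ⟨hτ, hy⟩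
    · simp only [endParam, cylParam, ContinuousLinearEquiv.apply_symm_apply]

theorem lintegral_biUnion_finset_le {X β : Type*} [MeasurableSpace X] (μ : Measure X) (s : Finset β)
    (S : β → Set X) (F : X → ENNReal) :
    ∫⁻ p in ⋃ x ∈ s, S x, F p ∂μ ≤ ∑ x ∈ s, ∫⁻ p in S x, F p ∂μ := by
  classical
  induction s using Finset.induction_on with
  | empty => simp
  | insert x s hx ih =>
    rw [Finset.set_biUnion_insert, Finset.sum_insert hx]
    exact (lintegral_union_le _ _ _).trans (add_le_add le_rfl ih)

/-- The weighted Poincaré inequality on the cylindrical end. -/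
theorem ACylStructure.poincare_end [SecondCountableTopology M] [MeasurableSpace M] [BorelSpace M]
    [IsContinuousRiemannianBundle (EuclideanSpace ℝ (Fin (d + 1)))
      (fun p : M => TangentSpace (𝓡 (d + 1)) p)] {t : M → ℝ} (ht : A.IsCylCoord t) :
    ∃ T : ℝ, 0 ≤ T ∧ ∀ T', T ≤ T' → ∃ C : ℝ, 0 ≤ C ∧
      ∀ u : M → ℝ, ContMDiff (𝓡 (d + 1)) 𝓘(ℝ, ℝ) 1 u → HasCompactSupport u →
      ∫⁻ p in A.Uᶜ ∩ {p | T' < t p}, ENNReal.ofReal (cylWeight (t p)) * ENNReal.ofReal (u p ^ 2)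
          ∂(volumeMeasure (d + 1)) ≤
        ENNReal.ofReal C * ∫⁻ p in A.Uᶜ ∩ {p | T' < t p}, ENNReal.ofReal (cylWeight (t p)) *
          ENNReal.ofReal (‖riemGradient (d + 1) u p‖ ^ 2) ∂(volumeMeasure (d + 1)) := by
  obtain ⟨T, hT0, hT⟩ := A.exists_finite_cover
  refine ⟨T, hT0, fun T' hT' => ?_⟩
  obtain ⟨s, r, k, K, hψ, hcov⟩ := hT T' hT'
  have hT'0 : 0 ≤ T' := hT0.trans hT'
  set Ω : L → Set (EuclideanSpace ℝ (Fin (d + 1))) := fun x =>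
    cylCoord d ⁻¹' (Ioi T' ×ˢ Metric.ball (extChartAt (𝓡 d) x x) (r x)) with hΩ
  have htτ : ∀ x, ∀ y ∈ Ω x, t (endParam A x y) = (cylCoord d y).1 := fun x y hy =>
    ht.apply_Φ _ (hT'0.trans (le_of_lt hy.1)) _
  have hend : ∀ x, endParam A x '' Ω x ⊆ A.Uᶜ ∩ {p | T' < t p} := by
    rintro x _ ⟨y, hy, rfl⟩
    refine ⟨?_, ?_⟩
    · rw [← A.target_eq]
      refine A.Φ.map_source ?_
      rw [A.source_eq]
      exact ⟨hT'0.trans (le_of_lt hy.1), mem_univ _⟩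
    · simp only [mem_ofPred_eq, htτ x y hy]; exact hy.1
  have hsub : A.Uᶜ ∩ {p | T' < t p} ⊆ ⋃ x ∈ s, endParam A x '' Ω x := by
    rintro p ⟨hp, hpt⟩
    obtain ⟨τ, hτ, z, rfl⟩ := A.exists_eq_of_notMem hp
    simp only [mem_ofPred_eq, ht.apply_Φ τ hτ z] at hpt
    obtain ⟨x, hx, hmem⟩ := hcov τ z hpt
    exact mem_iUnion₂.2 ⟨x, hx, hmem⟩
  have hloc := fun x => (hψ x).poincare_end ht.contMDiff.continuous
    -- `h` is the unit axial vector: moving along it by `s` raises the coordinate `t` by `s` and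
    -- leaves the cross-section fixed.
    (τ := fun y => (cylCoord d y).1) (by fun_prop) (htτ x) (h := (cylCoord d).symm (1, 0))
    (fun y σ => by simp) (fun y hy σ hσ => by
      have h1 : T' < (cylCoord d y).1 := hy.1
      refine ⟨?_, ?_⟩
      · simp only [map_add, map_smul, ContinuousLinearEquiv.apply_symm_apply, mem_Ioi]
        simp; linarith [hσ.1]
      · have h2 := hy.2
        simpa using h2)
  choose C hC hCu using hloc
  refine ⟨∑ x ∈ s, C x, Finset.sum_nonneg fun x _ => hC x, fun u hu hs => ?_⟩
  set F : M → ENNReal := fun p => ENNReal.ofReal (cylWeight (t p)) * ENNReal.ofReal (u p ^ 2)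
  calc ∫⁻ p in A.Uᶜ ∩ {p | T' < t p}, F p ∂(volumeMeasure (d + 1))
      ≤ ∫⁻ p in ⋃ x ∈ s, endParam A x '' Ω x, F p ∂(volumeMeasure (d + 1)) := lintegral_mono_set hsub
    _ ≤ ∑ x ∈ s, ∫⁻ p in endParam A x '' Ω x, F p ∂(volumeMeasure (d + 1)) :=
        lintegral_biUnion_finset_le _ _ _ _
    _ ≤ ∑ x ∈ s, ENNReal.ofReal (C x) * ∫⁻ p in A.Uᶜ ∩ {p | T' < t p},
          ENNReal.ofReal (cylWeight (t p)) * ENNReal.ofReal (‖riemGradient (d + 1) u p‖ ^ 2)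
          ∂(volumeMeasure (d + 1)) := by
        refine Finset.sum_le_sum fun x _ => (hCu x u hu hs).trans ?_
        gcongr
        exact hend x
    _ = _ := by rw [← Finset.sum_mul, ENNReal.ofReal_sum_of_nonneg fun x _ => hC x]

end Geometry

/-! ### Gluing the end to the core -/

section Main

variable {d : ℕ} {L : Type*} [TopologicalSpace L] [CompactSpace L] [Nonempty L]
    [ChartedSpace (EuclideanSpace ℝ (Fin d)) L] [IsManifold (𝓡 d) ∞ L]
    {M : Type*} [MetricSpace M] [SecondCountableTopology M] [ConnectedSpace M] [CompleteSpace M]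
    [MeasurableSpace M] [BorelSpace M]
    [ChartedSpace (EuclideanSpace ℝ (Fin (d + 1))) M] [IsManifold (𝓡 (d + 1)) ∞ M]
    [RiemannianBundle (fun p : M => TangentSpace (𝓡 (d + 1)) p)]
    [IsContinuousRiemannianBundle (EuclideanSpace ℝ (Fin (d + 1)))
      (fun p : M => TangentSpace (𝓡 (d + 1)) p)]
    [IsRiemannianManifold (𝓡 (d + 1)) M]
    (A : ACylStructure d L M)

/-- `f` is bounded below: by compactness on the closure of `U`, and by `2t - C₀ ≥ -C₀` on the end.
-/
theorem ACylStructure.exists_pos_add {t : M → ℝ} (ht : A.IsCylCoord t) {f : M → ℝ}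
    (hf : Continuous f) {C₀ : ℝ} (hft : ∀ p, 0 ≤ t p → |f p - 2 * t p| ≤ C₀) :
    ∃ c : ℝ, 0 < c ∧ ∀ p : M, 0 < f p + c := by
  obtain ⟨b, hb⟩ := (A.isCompact_closure_U.image hf).bddBelow
  refine ⟨|b| + |C₀| + 1, by positivity, fun p => ?_⟩
  have h1 := neg_abs_le b
  have h2 := le_abs_self C₀
  have h3 := abs_nonneg b
  have h4 := abs_nonneg C₀
  by_cases hp : p ∈ A.U
  · have := hb (mem_image_of_mem f (subset_closure hp))
    linarith
  · obtain ⟨s, hs, x, rfl⟩ := A.exists_eq_of_notMem hp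
    have hts := ht.apply_Φ s hs x
    have := (abs_le.1 (hft (A.Φ (s, x)) (by rw [hts]; exact hs))).1
    rw [hts] at this
    linarith

theorem ACylStructure.weighted_poincare {t : M → ℝ} (ht : A.IsCylCoord t) {f : M → ℝ}
    (hf : Continuous f) {C₀ : ℝ} (hC₀ : 0 ≤ C₀) (hft : ∀ p, 0 ≤ t p → |f p - 2 * t p| ≤ C₀)
    {c : ℝ} (hc : 0 < c) (hfc : ∀ p, 0 < f p + c) :
    ∃ C : ℝ, 0 ≤ C ∧ ∀ u : M → ℝ, ContMDiff (𝓡 (d + 1)) 𝓘(ℝ, ℝ) 1 u → HasCompactSupport u →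
      ∫⁻ p, ENNReal.ofReal (u p ^ 2 * (Real.exp (f p) / (f p + c) ^ 2)) ∂(volumeMeasure (d + 1)) ≤
        ENNReal.ofReal C * ∫⁻ p, ENNReal.ofReal (‖riemGradient (d + 1) u p‖ ^ 2 *
          (Real.exp (f p) / (f p + c) ^ 2)) ∂(volumeMeasure (d + 1)) := by
  set w : M → ℝ := fun p => Real.exp (f p) / (f p + c) ^ 2 with hw
  have hwpos : ∀ p, 0 < w p := fun p => div_pos (Real.exp_pos _) (pow_pos (hfc p) 2)
  have hwc : Continuous w := (Real.continuous_exp.comp hf).div ((hf.add continuous_const).pow 2)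
    fun p => (pow_pos (hfc p) 2).ne'
  have htc : Continuous t := ht.contMDiff.continuous
  obtain ⟨T, hT0, hT⟩ := A.poincare_end ht
  obtain ⟨T₁, hT₁⟩ := (A.isCompact_closure_U.image htc).bddAbove
  -- Beyond `T` the end estimate holds, beyond `C₀ + 1` the weights are comparable, and beyond `T₁`
  -- the set `{t > T'}` avoids `U`, where `t` is an arbitrary extension.
  set T' := max T (max (C₀ + 1) T₁)
  have hT'0 : 0 ≤ T' := hT0.trans (le_max_left _ _)
  have hT'C : C₀ + 1 ≤ T' := (le_max_left _ _).trans (le_max_right _ _)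
  have hT'1 : T₁ ≤ T' := (le_max_right _ _).trans (le_max_right _ _)
  obtain ⟨C₁, hC₁, hend⟩ := hT T' (le_max_left _ _)
  set Z : Set M := A.Uᶜ ∩ {p | T' < t p}
  have hZ : MeasurableSet Z := A.isOpen_U.measurableSet.compl.inter
    (isOpen_lt continuous_const htc).measurableSet
  set a := Real.exp (-C₀) / (2 * (2 + C₀ + c) ^ 2)
  set b := Real.exp C₀
  have ha : 0 < a := by positivity
  have hb : 0 < b := Real.exp_pos _
  have hcmp : ∀ p ∈ Z, a * cylWeight (t p) ≤ w p ∧ w p ≤ b * cylWeight (t p) := fun p hp =>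
    weight_comparison hC₀ hc (hT'C.trans (le_of_lt hp.2)) (hft p (hT'0.trans (le_of_lt hp.2)))
  have hZend : ∀ u : M → ℝ, ContMDiff (𝓡 (d + 1)) 𝓘(ℝ, ℝ) 1 u → HasCompactSupport u →
      ∫⁻ p in Z, ENNReal.ofReal (cylWeight (t p)) * ENNReal.ofReal (u p ^ 2)
        ∂(volumeMeasure (d + 1)) ≤ ENNReal.ofReal (C₁ * a⁻¹) *
        ∫⁻ p, ENNReal.ofReal (w p) * ENNReal.ofReal (‖riemGradient (d + 1) u p‖ ^ 2)
          ∂(volumeMeasure (d + 1)) := by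
    intro u hu hs
    refine (hend u hu hs).trans ?_
    rw [ENNReal.ofReal_mul hC₁, mul_assoc]
    gcongr
    rw [← lintegral_const_mul' _ _ ENNReal.ofReal_ne_top]
    refine le_trans ?_ (setLIntegral_le_lintegral Z _)
    refine setLIntegral_mono' hZ fun p hp => ?_
    rw [← mul_assoc, ← ENNReal.ofReal_mul (inv_nonneg.2 ha.le)]
    refine mul_le_mul_left (ENNReal.ofReal_le_ofReal ?_) _
    rw [le_inv_mul_iff₀ ha]
    exact (hcmp p hp).1
  -- The starting point of the propagation: the model weight is at least `1` there, so the weighted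
  -- estimate controls the plain `L²`-norm.
  have hO : EnergyControls (d + 1) w {p | T' < t p} := by
    refine ⟨C₁ * a⁻¹, by positivity, fun u hu hs => le_trans ?_ (hZend u hu hs)⟩
    have hsub : {p | T' < t p} ⊆ Z := fun p hp => ⟨fun hU => by
      have := hT₁ (mem_image_of_mem t (subset_closure hU))
      have hp : T' < t p := hp
      linarith, hp⟩
    refine (lintegral_mono_set hsub).trans (setLIntegral_mono' hZ fun p hp => ?_)
    refine le_mul_of_one_le_left zero_le ?_
    rw [← ENNReal.ofReal_one]
    exact ENNReal.ofReal_le_ofReal (one_le_cylWeight (hT'0.trans (le_of_lt hp.2)))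
  have hne : {p | T' < t p}.Nonempty := by
    obtain ⟨x⟩ := ‹Nonempty L›
    refine ⟨A.Φ (T' + 1, x), ?_⟩
    simp only [mem_ofPred_eq, ht.apply_Φ (T' + 1) (by linarith) x]
    linarith
  -- The compact core. On it `w` is bounded above, so control of the plain `L²`-norm suffices;
  -- together with `Z` it covers `M`.
  set Q := closure A.U ∪ A.Φ '' (Icc 0 T' ×ˢ univ)
  have hQ : IsCompact Q := A.isCompact_closure_U.union (A.isCompact_image_Icc T')
  obtain ⟨C₂, hC₂, hQu⟩ := energyControls_of_isCompact hwc hwpos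
    (isOpen_lt continuous_const htc) hne hO hQ
  obtain ⟨w₁, hw₁⟩ := (hQ.image hwc).bddAbove
  have hcover : (univ : Set M) ⊆ Q ∪ Z := by
    intro p _
    by_cases hp : p ∈ A.U
    · exact Or.inl (Or.inl (subset_closure hp))
    · obtain ⟨s, hs, x, rfl⟩ := A.exists_eq_of_notMem hp
      rcases le_or_gt s T' with h | h
      · exact Or.inl (Or.inr ⟨(s, x), ⟨⟨hs, h⟩, mem_univ _⟩, rfl⟩)
      · exact Or.inr ⟨hp, by simpa [ht.apply_Φ s hs x] using h⟩
  refine ⟨|w₁| * C₂ + b * (C₁ * a⁻¹), by positivity, fun u hu hs => ?_⟩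
  set D := ∫⁻ p, ENNReal.ofReal (w p) * ENNReal.ofReal (‖riemGradient (d + 1) u p‖ ^ 2)
    ∂(volumeMeasure (d + 1)) with hD
  have hDeq : ∫⁻ p, ENNReal.ofReal (‖riemGradient (d + 1) u p‖ ^ 2 * w p)
      ∂(volumeMeasure (d + 1)) = D :=
    lintegral_congr fun p => by rw [mul_comm, ENNReal.ofReal_mul (hwpos p).le]
  rw [hDeq]
  have hQi : ∫⁻ p in Q, ENNReal.ofReal (u p ^ 2 * w p) ∂(volumeMeasure (d + 1)) ≤
      ENNReal.ofReal |w₁| * (ENNReal.ofReal C₂ * D) := by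
    refine le_trans ?_ (mul_le_mul_right (hQu u hu hs) _)
    rw [← lintegral_const_mul' _ _ ENNReal.ofReal_ne_top]
    refine setLIntegral_mono' hQ.measurableSet fun p hp => ?_
    rw [mul_comm, ENNReal.ofReal_mul (hwpos p).le]
    gcongr
    exact (hw₁ (mem_image_of_mem w hp)).trans (le_abs_self _)
  have hZi : ∫⁻ p in Z, ENNReal.ofReal (u p ^ 2 * w p) ∂(volumeMeasure (d + 1)) ≤
      ENNReal.ofReal b * (ENNReal.ofReal (C₁ * a⁻¹) * D) := by
    refine le_trans ?_ (mul_le_mul_right (hZend u hu hs) _)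
    rw [← lintegral_const_mul' _ _ ENNReal.ofReal_ne_top]
    refine setLIntegral_mono' hZ fun p hp => ?_
    rw [mul_comm, ENNReal.ofReal_mul (hwpos p).le, ← mul_assoc, ← ENNReal.ofReal_mul hb.le]
    gcongr
    exact (hcmp p hp).2
  calc ∫⁻ p, ENNReal.ofReal (u p ^ 2 * w p) ∂(volumeMeasure (d + 1))
      = ∫⁻ p in univ, ENNReal.ofReal (u p ^ 2 * w p) ∂(volumeMeasure (d + 1)) := by
        rw [Measure.restrict_univ]
    _ ≤ ∫⁻ p in Q ∪ Z, ENNReal.ofReal (u p ^ 2 * w p) ∂(volumeMeasure (d + 1)) :=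
        lintegral_mono_set hcover
    _ ≤ _ := lintegral_union_le _ _ _
    _ ≤ _ := add_le_add hQi hZi
    _ = _ := by
        rw [ENNReal.ofReal_add (by positivity) (by positivity),
          ENNReal.ofReal_mul (abs_nonneg w₁), ENNReal.ofReal_mul hb.le]
        ring

end Main

end ACyl

end


/-! ### The proposition, with real-valued integrals -/

theorem proposition2p12 (d : ℕ)
    {L : Type*} [TopologicalSpace L] [T2Space L] [CompactSpace L] [ConnectedSpace L]
    [ChartedSpace (EuclideanSpace ℝ (Fin d)) L] [IsManifold (𝓡 d) ∞ L]
    {M : Type*} [MetricSpace M] [SecondCountableTopology M] [ConnectedSpace M] [CompleteSpace M]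
    [MeasurableSpace M] [BorelSpace M]
    [ChartedSpace (EuclideanSpace ℝ (Fin (d + 1))) M] [IsManifold (𝓡 (d + 1)) ∞ M]
    [RiemannianBundle (fun p : M => TangentSpace (𝓡 (d + 1)) p)]
    [IsContMDiffRiemannianBundle (𝓡 (d + 1)) ∞ (EuclideanSpace ℝ (Fin (d + 1)))
      (fun p : M => TangentSpace (𝓡 (d + 1)) p)]
    [IsRiemannianManifold (𝓡 (d + 1)) M]
    (A : ACyl.ACylStructure d L M) (t : M → ℝ) (ht : A.IsCylCoord t)
    (f : M → ℝ) (hf : ContMDiff (𝓡 (d + 1)) 𝓘(ℝ, ℝ) 2 f)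
    (δ₀ : ℝ) (hδ₀ : 0 < δ₀)
    (hft : ACyl.MemWeighted d t 2 δ₀ (fun p => f p - 2 * t p)) :
    (∃ c : ℝ, 0 < c ∧ ∀ p : M, 0 < f p + c) ∧
    ∀ c : ℝ, 0 < c → (∀ p : M, 0 < f p + c) →
      ∃ lam : ℝ, 0 < lam ∧
        ∀ u : M → ℝ, ContMDiff (𝓡 (d + 1)) 𝓘(ℝ, ℝ) ∞ u → HasCompactSupport u →
          lam * ∫ p, u p ^ 2 * (Real.exp (f p) / (f p + c) ^ 2) ∂(ACyl.volumeMeasure (d + 1)) ≤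
            ∫ p, ‖ACyl.riemGradient (d + 1) u p‖ ^ 2 * (Real.exp (f p) / (f p + c) ^ 2)
              ∂(ACyl.volumeMeasure (d + 1)) := by
  have : IsContinuousRiemannianBundle (EuclideanSpace ℝ (Fin (d + 1)))
      (fun p : M => TangentSpace (𝓡 (d + 1)) p) := by
    obtain ⟨g, hg, hgi⟩ := IsContMDiffRiemannianBundle.exists_contMDiff (IB := 𝓡 (d + 1)) (n := ∞)
      (F := EuclideanSpace ℝ (Fin (d + 1))) (E := fun p : M => TangentSpace (𝓡 (d + 1)) p)
    exact ⟨g, hg.continuous, hgi⟩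
  obtain ⟨C₀, hC₀, hbound⟩ := hft.exists_abs_le hδ₀
  refine ⟨A.exists_pos_add ht hf.continuous hbound, fun c hc hfc => ?_⟩
  obtain ⟨C, hC, hineq⟩ := A.weighted_poincare ht hf.continuous hC₀ hbound hc hfc
  -- `C` may vanish, so `C + 1` is inverted.
  refine ⟨(C + 1)⁻¹, by positivity, fun u hu hs => ?_⟩
  have hu1 : ContMDiff (𝓡 (d + 1)) 𝓘(ℝ, ℝ) 1 u := hu.of_le (by simp)
  have hgrad := ACyl.continuous_norm_sq_riemGradient hu1
  have hwc : Continuous fun p => Real.exp (f p) / (f p + c) ^ 2 :=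
    (Real.continuous_exp.comp hf.continuous).div ((hf.continuous.add continuous_const).pow 2)
      fun p => (pow_pos (hfc p) 2).ne'
  have hw0 : ∀ p, 0 ≤ Real.exp (f p) / (f p + c) ^ 2 := fun p => by positivity
  have hc1 := (hu1.continuous.pow 2).mul hwc
  have hc2 := hgrad.mul hwc
  have hs2 : HasCompactSupport fun p =>
      ‖ACyl.riemGradient (d + 1) u p‖ ^ 2 * (Real.exp (f p) / (f p + c) ^ 2) := by
    refine HasCompactSupport.mul_right (f := fun p => ‖ACyl.riemGradient (d + 1) u p‖ ^ 2) ?_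
    refine HasCompactSupport.of_support_subset_isCompact hs fun p hp => ?_
    by_contra hpu
    exact hp (by show ‖ACyl.riemGradient (d + 1) u p‖ ^ 2 = 0; rw [ACyl.riemGradient_eq_zero_of_notMem_tsupport hpu]; simp)
  -- Finiteness of the energy is essential for `ENNReal.toReal_mono`, since `toReal` sends `⊤` to
  -- `0`.
  have htop := ACyl.lintegral_lt_top_of_hasCompactSupport (m := d + 1) hc2 hs2
  have hle := hineq u hu1 hs
  rw [integral_eq_lintegral_of_nonneg_ae (Eventually.of_forall fun p =>
      mul_nonneg (sq_nonneg _) (hw0 p)) hc1.aestronglyMeasurable,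
    integral_eq_lintegral_of_nonneg_ae (Eventually.of_forall fun p =>
      mul_nonneg (sq_nonneg _) (hw0 p)) hc2.aestronglyMeasurable]
  have hreal := ENNReal.toReal_mono (ENNReal.mul_ne_top ENNReal.ofReal_ne_top htop.ne) hle
  rw [ENNReal.toReal_mul, ENNReal.toReal_ofReal hC] at hreal
  rw [inv_mul_le_iff₀ (by positivity)]
  refine hreal.trans (mul_le_mul_of_nonneg_right (by linarith) ENNReal.toReal_nonneg)
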